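/- Let $p$ be a prime and let $(R,\mathfrak m,k)$ be a Noetherian local ring of characteristic $p$ and Krull dimension $d$ which is $F$-finite: $F_*R$ is a finitely generated $R$-module, where $F^e_*R$ denotes the abelian group $R$ with $r\in R$ acting as multiplication by $r^{p^e}$. Put $\alpha(R)=\log_p[k:k^p]$. A Cartier subalgebra on $R$ is a graded $\mathbb F_p$-subalgebra $\mathscr D=\bigoplus_{e\ge 0}\mathscr D_e$ of $\bigoplus_{e\ge 0}\operatorname{Hom}_R(F^e_*R,R)$ (multiplication being composition of additive maps $R\to R$) with $\mathscr D_0=\operatorname{Hom}_R(R,R)$ and $\mathscr D_e\ne 0$ for some $e>0$. In a direct sum decomposition $F^e_*R=\bigoplus_i M_i$ of $R$-modules, $M_j$ is called a $\mathscr D$-summand if $M_j\cong R$ and the projection $F^e_*R\to M_j\cong R$ belongs to $\mathscr D_e$. Let $a_e^{\mathscr D}$ be the maximal number of $\mathscr D$-summands in a direct sum decomposition of $F^e_*R$, let $\Gamma_{\mathscr D}=\{e\ge 0 : a_e^{\mathscr D}\neq 0\}$ and $n_{\mathscr D}=\gcd(\Gamma_{\mathscr D})$. **Theorem.** Let $\mathscr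 D$ be a Cartier subalgebra on such a ring $R$. If $n_{\mathscr D}\neq 0$, i.e. $\Gamma_{\mathscr D}\neq\{0\}$, then $\Gamma_{\mathscr D}$ is infinite, both of the limits $$s(R,\mathscr D)=\lim_{e\in\Gamma_{\mathscr D},\ e\to\infty}\frac{a_e^{\mathscr D}}{p^{e(d+\alpha(R))}}=\lim_{m\to\infty}\frac{a_{mn_{\mathscr D}}^{\mathscr D}}{p^{mn_{\mathscr D}(d+\alpha(R))}}$$ exist in $\mathbb R$, and they are equal; their common value is called the $F$-signature $s(R,\mathscr D)$ of $(R,\mathscr D)$. If $n_{\mathscr D}=0$, then $a_e^{\mathscr D}=0$ for all $e>0$, and $s(R,\mathscr D)=0$ by convention. -/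

import Mathlib

open Filter Topology

universe u

/-- The Frobenius push-forward `F^e_* R`: a copy of the abelian group `R`, on which `r : R` acts as
multiplication by `r ^ (p ^ e)` (see the `Module` instance below). -/
def FrobeniusPushforward (_p _e : ℕ) (R : Type u) : Type u := R

namespace FrobeniusPushforward

variable {p e : ℕ} {R : Type u} [CommRing R]

instance : AddCommGroup (FrobeniusPushforward p e R) := inferInstanceAs (AddCommGroup R)

/-- The identification of abelian groups `R ≃ F^e_* R`, usually written `x ↦ F^e_* x`. -/
def of (p e : ℕ) {R : Type u} [CommRing R] : R ≃+ FrobeniusPushforward p e R := AddEquiv.refl R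

/-- Restriction of scalars along the `e`-th iterate of the Frobenius endomorphism. -/
instance [ExpChar R p] : Module R (FrobeniusPushforward p e R) :=
  Module.compHom R (iterateFrobenius R p e)

theorem smul_of [ExpChar R p] (r x : R) : r • of p e x = of p e (r ^ p ^ e * x) := rfl

end FrobeniusPushforward

/-- The group `Hom_R(F^e_* R, R)` of `p^{-e}`-linear maps on `R`. -/
abbrev CartierMap (p e : ℕ) (R : Type u) [CommRing R] [ExpChar R p] : Type u :=
  FrobeniusPushforward p e R →ₗ[R] R

/-- The product of the total Cartier algebra: the composition of `φ` and `ψ`, viewed as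
additive maps on `R`. -/
def CartierMap.mul {p e₁ e₂ : ℕ} {R : Type u} [CommRing R] [ExpChar R p]
    (φ : CartierMap p e₁ R) (ψ : CartierMap p e₂ R) : CartierMap p (e₁ + e₂) R where
  toFun x := φ (.of p e₁ (ψ (.of p e₂ ((FrobeniusPushforward.of p (e₁ + e₂)).symm x))))
  map_add' x y := by simp
  map_smul' r x := by
    obtain ⟨x, rfl⟩ := (FrobeniusPushforward.of p (e₁ + e₂)).surjective x
    rw [FrobeniusPushforward.smul_of, AddEquiv.symm_apply_apply, AddEquiv.symm_apply_apply,
      pow_add, pow_mul, ← FrobeniusPushforward.smul_of, map_smul, smul_eq_mul,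
      ← FrobeniusPushforward.smul_of, map_smul, RingHom.id_apply]

/-- A Cartier subalgebra on `R`: a graded `𝔽_p`-subalgebra `D = ⨁ D_e` of the total Cartier algebra
`⨁ Hom_R(F^e_* R, R)` with `D_0 = Hom_R(R, R)` and `D_e ≠ 0` for some `e > 0`, given by its
homogeneous components. (The unit lies in `D_0`, and `𝔽_p`-linear combinations are sums.) -/
structure CartierSubalgebra (p : ℕ) (R : Type u) [CommRing R] [ExpChar R p] where
  /-- The homogeneous component of degree `e`. -/
  component : ∀ e : ℕ, AddSubgroup (CartierMap p e R)
  component_zero : component 0 = ⊤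
  mul_mem : ∀ {e₁ e₂ : ℕ} {φ : CartierMap p e₁ R} {ψ : CartierMap p e₂ R},
    φ ∈ component e₁ → ψ ∈ component e₂ → φ.mul ψ ∈ component (e₁ + e₂)
  exists_ne_bot : ∃ e : ℕ, 0 < e ∧ component e ≠ ⊥

/-- `R` is `F`-finite if `F_* R` is a finitely generated `R`-module. -/
def IsFFinite (p : ℕ) (R : Type u) [CommRing R] [ExpChar R p] : Prop :=
  Module.Finite R (FrobeniusPushforward p 1 R)

instance residueField_charP (p : ℕ) [Fact p.Prime] (R : Type u) [CommRing R] [IsLocalRing R]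
    [CharP R p] : CharP (IsLocalRing.ResidueField R) p :=
  (CharP.charP_iff_prime_eq_zero Fact.out).mpr <| by
    rw [← map_natCast (IsLocalRing.residue R), CharP.cast_eq_zero, map_zero]

/-- `α(R) = log_p [k : k^p]`, where `k` is the residue field of the local ring `R`. -/
noncomputable def frobeniusAlpha (p : ℕ) [Fact p.Prime] (R : Type u) [CommRing R] [IsLocalRing R]
    [CharP R p] : ℝ :=
  Real.logb p (Module.finrank (frobenius (IsLocalRing.ResidueField R) p).fieldRange
    (IsLocalRing.ResidueField R))

/-- The projection of `M` onto the `j`-th summand of an internal direct sum decomposition. -/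
noncomputable def internalProj {R M ι : Type*} [Ring R] [AddCommGroup M] [Module R M]
    [DecidableEq ι] {N : ι → Submodule R M} (h : DirectSum.IsInternal N) (j : ι) : M →ₗ[R] N j :=
  DirectSum.component R ι (fun i => N i) j ∘ₗ
    (LinearEquiv.ofBijective (DirectSum.coeLinearMap N) h).symm.toLinearMap

namespace CartierSubalgebra

section Splitting

variable {p : ℕ} {R : Type u} [CommRing R] [ExpChar R p] (D : CartierSubalgebra p R)

/-- In the direct sum decomposition `F^e_* R = ⨁ N i`, the summand `N j` is a `D`-summand if it is
isomorphic to `R` and the projection `F^e_* R → N j ≃ R` belongs to `D_e`. -/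
def IsSummand {e n : ℕ} {N : Fin n → Submodule R (FrobeniusPushforward p e R)}
    (h : DirectSum.IsInternal N) (j : Fin n) : Prop :=
  ∃ f : N j ≃ₗ[R] R, f.toLinearMap ∘ₗ internalProj h j ∈ D.component e

/-- The `e`-th `F`-splitting number `a_e` of `(R, D)`: the maximal number of `D`-summands in a
direct sum decomposition of `F^e_* R` as an `R`-module. -/
noncomputable def splittingNumber (e : ℕ) : ℕ :=
  sSup {a : ℕ | ∃ (n : ℕ) (N : Fin n → Submodule R (FrobeniusPushforward p e R))
    (h : DirectSum.IsInternal N), a = {j : Fin n | D.IsSummand h j}.ncard}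

/-- The semigroup `Γ_D` of those `e ≥ 0` with `a_e ≠ 0`. -/
def semigroup : Set ℕ := {e | D.splittingNumber e ≠ 0}

/-- The semigroup index `n_D = gcd Γ_D`. -/
noncomputable def semigroupIndex : ℕ := Nat.setGcd D.semigroup

end Splitting

variable {p : ℕ} [Fact p.Prime] {R : Type u} [CommRing R] [IsLocalRing R] [CharP R p]
  (D : CartierSubalgebra p R)

/-- The quotient `a_e / p ^ (e (d + α(R)))`. -/
noncomputable def normalizedSplittingNumber (d e : ℕ) : ℝ :=
  D.splittingNumber e / (p : ℝ) ^ ((e : ℝ) * (d + frobeniusAlpha p R))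

open Classical in
/-- The `F`-signature `s(R, D)` of `(R, D)`, where `d = dim R`: the limit of
`a_e / p ^ (e (d + α(R)))` over `e ∈ Γ_D`. If `n_D = 0`, that is, if `Γ_D` has no positive element,
there is no such limit to take, and `s(R, D) = 0` by convention. -/
noncomputable def fSignature (d : ℕ) : ℝ :=
  if D.semigroupIndex = 0 then 0
  else limUnder (atTop ⊓ 𝓟 D.semigroup) (D.normalizedSplittingNumber d)

end CartierSubalgebra

/-! The splitting number `a_e` is the length of `F^e_* (R / I_e)`, where `I_e` is the ideal of
the `r` that every `φ ∈ D_e` maps into `𝔪`. As `I_e` contains `x ^ p ^ e` for all `x ∈ 𝔪`, it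
follows that `a_e = O(δ ^ e)`, where `δ = p ^ d [k : k ^ p] = p ^ (d + α(R))`. Composing split
maps shows that `Γ_D` is a semigroup, and that `R` is reduced if `Γ_D` has a positive element.

If `R` is reduced but not a domain, the `I_e` share a nonzerodivisor, which lowers the dimension
and gives `a_e / δ ^ e = O(p ^ (-e))`. If `R` is a domain and `F_* R` has rank `r`, then
`a_e ≤ r ^ e`, so the limit is `0` when `r < δ`. If `r ≥ δ`, a split map `φ ∈ D_t` yields `r ^ t`
linearly independent forms `φ (x · )` on `F^t_* R`, which by Cramer's rule map onto a full
lattice; composing them with `D_e` gives `r ^ t a_e ≤ a_{e + t} + O((δ / p) ^ e)` for every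
`t ∈ Γ_D`. Hence `a_e / δ ^ e` increases along `Γ_D` up to a geometric error, and a bounded
sequence of this kind converges. -/

/-! ### Lengths of quotients by ideals containing Frobenius powers -/

section Length

theorem length_le_add_of_ker_le_range {R M N P : Type*} [Ring R] [AddCommGroup M] [AddCommGroup N]
    [AddCommGroup P] [Module R M] [Module R N] [Module R P] (f : N →ₗ[R] M) (g : M →ₗ[R] P)
    (h : LinearMap.ker g ≤ LinearMap.range f) :
    Module.length R M ≤ Module.length R N + Module.length R P := by
  rw [Module.length_eq_add_of_exact (LinearMap.ker g).subtype g.rangeRestrict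
    (Submodule.subtype_injective _) g.surjective_rangeRestrict
    (by rw [LinearMap.exact_iff, LinearMap.ker_rangeRestrict, Submodule.range_subtype])]
  gcongr
  · exact (Module.length_le_of_injective (Submodule.inclusion h)
      (Submodule.inclusion_injective h)).trans
        (Module.length_le_of_surjective f.rangeRestrict f.surjective_rangeRestrict)
  · exact Module.length_le_of_injective _ (LinearMap.range g).subtype_injective

variable {R : Type*} [CommRing R]

theorem length_quotient_anti {I J : Ideal R} (h : I ≤ J) :
    Module.length R (R ⧸ J) ≤ Module.length R (R ⧸ I) :=
  Module.length_le_of_surjective (Submodule.factor h) (Submodule.factor_surjective h)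

theorem length_quotient_sup_span_mul_le (J : Ideal R) (x y : R) :
    Module.length R (R ⧸ (J ⊔ Ideal.span {x * y})) ≤
      Module.length R (R ⧸ (J ⊔ Ideal.span {x})) + Module.length R (R ⧸ (J ⊔ Ideal.span {y})) := by
  have hx : J ⊔ Ideal.span {x} ≤
      Submodule.comap (LinearMap.mulLeft R y) (J ⊔ Ideal.span {x * y}) := by
    refine sup_le (fun a ha => Ideal.mem_sup_left (J.mul_mem_left _ ha)) ?_
    rw [Ideal.span_singleton_le_iff_mem, Submodule.mem_comap, LinearMap.mulLeft_apply, mul_comm]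
    exact Ideal.mem_sup_right (Ideal.mem_span_singleton_self _)
  have hy : J ⊔ Ideal.span {x * y} ≤ J ⊔ Ideal.span {y} :=
    sup_le_sup_left (Ideal.span_singleton_le_span_singleton.mpr (dvd_mul_left y x)) _
  refine length_le_add_of_ker_le_range (Submodule.mapQ _ _ _ hx) (Submodule.factor hy) ?_
  intro a ha
  obtain ⟨a, rfl⟩ := Submodule.Quotient.mk_surjective _ a
  obtain ⟨j, hj, _, hz, rfl⟩ := Submodule.mem_sup.mp ((Submodule.Quotient.mk_eq_zero _).mp ha)
  obtain ⟨b, rfl⟩ := Ideal.mem_span_singleton'.mp hz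
  refine ⟨Submodule.Quotient.mk b, ?_⟩
  rw [Submodule.mapQ_apply, LinearMap.mulLeft_apply, Submodule.Quotient.eq, mul_comm y b,
    sub_add_cancel_right]
  exact Ideal.mem_sup_left (J.neg_mem hj)

theorem length_quotient_sup_span_pow_le (J : Ideal R) (x : R) (n : ℕ) :
    Module.length R (R ⧸ (J ⊔ Ideal.span {x ^ n})) ≤
      n * Module.length R (R ⧸ (J ⊔ Ideal.span {x})) := by
  induction n with
  | zero => simp [Ideal.span_singleton_one]
  | succ n ih =>
    rw [pow_succ, Nat.cast_add_one, add_one_mul]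
    exact (length_quotient_sup_span_mul_le J _ x).trans (by gcongr)

theorem length_quotient_sup_span_image_pow_le (s : Finset R) (J : Ideal R) (n : ℕ) :
    Module.length R (R ⧸ (J ⊔ Ideal.span ((· ^ n) '' (s : Set R)))) ≤
      n ^ s.card * Module.length R (R ⧸ (J ⊔ Ideal.span (s : Set R))) := by
  classical
  induction s using Finset.induction_on generalizing J with
  | empty => rw [Finset.coe_empty, Set.image_empty, Finset.card_empty, pow_zero, one_mul]
  | insert a s ha ih =>
    rw [Finset.coe_insert, Set.image_insert_eq, Ideal.span_insert, Ideal.span_insert, ← sup_assoc,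
      ← sup_assoc, Finset.card_insert_of_notMem ha, pow_succ, mul_assoc,
      sup_right_comm J (Ideal.span {a})]
    refine (ih _).trans ?_
    rw [sup_right_comm J (Ideal.span {a ^ n})]
    gcongr
    exact length_quotient_sup_span_pow_le _ _ _

section IsLocalRing

open IsLocalRing

variable [IsLocalRing R] [IsNoetherianRing R]

theorem exists_finset_card_le_isArtinianRing_quotient {t : ℕ} (ht : ringKrullDim R ≤ t) :
    ∃ s : Finset R, s.card ≤ t ∧ (s : Set R) ⊆ maximalIdeal R ∧
      IsArtinianRing (R ⧸ Ideal.span (s : Set R)) := by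
  obtain ⟨s, hs, hcard⟩ :=
    Ideal.exists_finset_card_eq_height_of_isNoetherianRing (maximalIdeal R)
  refine ⟨s, ?_, fun x hx => hs.1.2 (Ideal.subset_span hx),
    quotient_artinian_of_mem_minimalPrimes_of_isLocalRing _ hs⟩
  rw [← maximalIdeal_height_eq_ringKrullDim, ← hcard] at ht
  exact_mod_cast ht

theorem exists_finset_card_le_isArtinianRing_quotient_sup (I : Ideal R) {t : ℕ}
    (ht : ringKrullDim (R ⧸ I) ≤ t) :
    ∃ s : Finset R, s.card ≤ t ∧ (s : Set R) ⊆ maximalIdeal R ∧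
      IsArtinianRing (R ⧸ (I ⊔ Ideal.span (s : Set R))) := by
  classical
  obtain rfl | hI := eq_or_ne I ⊤
  · have : Subsingleton (R ⧸ ((⊤ : Ideal R) ⊔ Ideal.span ((∅ : Finset R) : Set R))) :=
      Ideal.Quotient.subsingleton_iff.mpr (top_sup_eq _)
    exact ⟨∅, by simp, by simp, inferInstance⟩
  have : Nontrivial (R ⧸ I) := Ideal.Quotient.nontrivial_iff.mpr hI
  have := IsLocalRing.of_surjective' (Ideal.Quotient.mk I) Ideal.Quotient.mk_surjective
  have := IsLocalHom.of_surjective (Ideal.Quotient.mk I) Ideal.Quotient.mk_surjective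
  obtain ⟨s, hcard, hs, _⟩ := exists_finset_card_le_isArtinianRing_quotient ht
  obtain ⟨g, hg⟩ := (Ideal.Quotient.mk_surjective (I := I)).hasRightInverse
  have himage : Ideal.Quotient.mk I '' ((s.image g : Finset R) : Set R) = s := by
    simp [Set.image_image, hg _]
  refine ⟨s.image g, Finset.card_image_le.trans hcard, fun x hx => ?_, ?_⟩
  · have hmem : Ideal.Quotient.mk I x ∈ maximalIdeal (R ⧸ I) :=
      hs (himage ▸ Set.mem_image_of_mem _ hx)
    simpa using hmem
  · have e := DoubleQuot.quotQuotEquivQuotSup I (Ideal.span ((s.image g : Finset R) : Set R))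
    rw [Ideal.map_span, himage] at e
    exact e.surjective.isArtinianRing

theorem exists_length_quotient_le_mul_pow (I : Ideal R) {t : ℕ} (ht : ringKrullDim (R ⧸ I) ≤ t) :
    ∃ C : ℕ, ∀ (q : ℕ) (J : Ideal R), 0 < q → I ≤ J → (∀ x ∈ maximalIdeal R, x ^ q ∈ J) →
      Module.length R (R ⧸ J) ≤ (C * q ^ t : ℕ) := by
  obtain ⟨s, hcard, hs, hartinian⟩ := exists_finset_card_le_isArtinianRing_quotient_sup I ht
  have hfinite : Module.length R (R ⧸ (I ⊔ Ideal.span (s : Set R))) ≠ ⊤ := by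
    rw [Module.length_eq_of_surjective (R := R ⧸ (I ⊔ Ideal.span (s : Set R)))
      Ideal.Quotient.mk_surjective]
    exact Module.length_ne_top
  obtain ⟨C, hC⟩ := ENat.ne_top_iff_exists.mp hfinite
  refine ⟨C, fun q J hq hIJ hJ => ?_⟩
  have hle : I ⊔ Ideal.span ((· ^ q) '' (s : Set R)) ≤ J :=
    sup_le hIJ (Ideal.span_le.mpr (Set.image_subset_iff.mpr fun x hx => hJ x (hs hx)))
  calc Module.length R (R ⧸ J)
      ≤ q ^ s.card * Module.length R (R ⧸ (I ⊔ Ideal.span (s : Set R))) :=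
        (length_quotient_anti hle).trans (length_quotient_sup_span_image_pow_le s I q)
    _ ≤ (C * q ^ t : ℕ) := by
        rw [← hC, mul_comm C]
        exact_mod_cast Nat.mul_le_mul_right C (Nat.pow_le_pow_right hq hcard)

theorem exists_mul_length_quotient_le_mul_pow {d : ℕ} (hd : ringKrullDim R ≤ d) {z : R}
    (hz : z ∈ nonZeroDivisors R) :
    ∃ C : ℕ, ∀ (q : ℕ) (J : Ideal R), 0 < q → z ∈ J → (∀ x ∈ maximalIdeal R, x ^ q ∈ J) →
      q * Module.length R (R ⧸ J) ≤ (C * q ^ d : ℕ) := by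
  have hdim := (ringKrullDim_quotient_succ_le_of_nonZeroDivisor hz).trans hd
  obtain htop | ⟨t, rfl, ht⟩ : Ideal.span {z} = ⊤ ∨
      ∃ t, d = t + 1 ∧ ringKrullDim (R ⧸ Ideal.span {z}) ≤ t := by
    obtain _ | t := d
    · left
      by_contra htop
      have : Nontrivial (R ⧸ Ideal.span {z}) := Ideal.Quotient.nontrivial_iff.mpr htop
      have := (add_le_add_left ringKrullDim_nonneg_of_nontrivial 1).trans hdim
      norm_num at this
    · rw [Nat.cast_add, Nat.cast_one] at hdim
      exact .inr ⟨t, rfl, ENat.WithBot.add_le_add_one_right_iff.mp hdim⟩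
  · refine ⟨0, fun q J _ hzJ _ => ?_⟩
    rw [← Ideal.span_singleton_le_iff_mem, htop, top_le_iff] at hzJ
    simp [hzJ]
  · obtain ⟨C, hC⟩ := exists_length_quotient_le_mul_pow _ ht
    refine ⟨C, fun q J hq hzJ hJ => ?_⟩
    rw [pow_succ', mul_left_comm, Nat.cast_mul]
    gcongr
    exact hC q J hq ((Ideal.span_singleton_le_iff_mem _).mpr hzJ) hJ

end IsLocalRing

end Length

/-! ### Restriction of scalars along Frobenius -/

section RestrictScalars

/-- The module `f_* M` obtained from a `B`-module `M` by restriction of scalars along a ring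
homomorphism `f : A → B`, on a copy of `M` so that it does not clash with `M` when `A = B`. Thus
`FrobeniusPushforward p e R` is `RestrictScalarsAlong (iterateFrobenius R p e) R`. -/
def RestrictScalarsAlong {A B : Type*} [CommRing A] [CommRing B] (_f : A →+* B) (M : Type*) :
    Type _ := M

namespace RestrictScalarsAlong

variable {A B : Type*} [CommRing A] [CommRing B] (f : A →+* B) (M : Type*) [AddCommGroup M]
  [Module B M]

instance : AddCommGroup (RestrictScalarsAlong f M) := inferInstanceAs (AddCommGroup M)

instance : Module A (RestrictScalarsAlong f M) := Module.compHom M f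

theorem length_eq [IsLocalRing A] [IsLocalRing B] [IsLocalHom f] :
    Module.length A (RestrictScalarsAlong f M) = Module.length B M *
      Module.length (IsLocalRing.ResidueField A) (RestrictScalarsAlong
        (IsLocalRing.ResidueField.map f) (IsLocalRing.ResidueField B)) := by
  let := f.toAlgebra
  let := Module.compHom M f
  have : IsScalarTower A B M := ⟨fun a b x => mul_smul (f a) b x⟩
  have : IsLocalHom (algebraMap A B) := ‹IsLocalHom f›
  let e : IsLocalRing.ResidueField B ≃ₗ[IsLocalRing.ResidueField A] RestrictScalarsAlong
      (IsLocalRing.ResidueField.map f) (IsLocalRing.ResidueField B) :=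
    { AddEquiv.refl _ with
      map_smul' := fun a b => by
        obtain ⟨a, rfl⟩ := IsLocalRing.residue_surjective a
        exact Algebra.smul_def (IsLocalRing.residue A a) b }
  rw [← e.length_eq]
  exact IsLocalRing.length_restrictScalars A B M

theorem finrank_comp {C : Type*} [CommRing C] [IsDomain C] (g : B →+* C)
    (hg : Function.Injective g) :
    Module.finrank A (RestrictScalarsAlong (g.comp f) C) =
      Module.finrank A (RestrictScalarsAlong f B) *
        Module.finrank B (RestrictScalarsAlong g C) := by
  algebraize [f, g, g.comp f]
  have : FaithfulSMul B C := (faithfulSMul_iff_algebraMap_injective B C).mpr hg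
  exact (Module.finrank_mul_finrank' (R := A) (S := B) C).symm

theorem finrank_fieldRange {K L : Type*} [Field K] [Field L] (f : K →+* L) :
    Module.finrank f.fieldRange L = Module.finrank K (RestrictScalarsAlong f L) := by
  algebraize [f]
  exact (Algebra.finrank_eq_of_equiv_equiv
    (RingEquiv.ofBijective f.rangeRestrictField f.rangeRestrictField_bijective)
    (RingEquiv.refl L) rfl).symm

end RestrictScalarsAlong

/-- The degree `[A : A^p]` of a ring `A` of characteristic `p` over its subring of `p`-th powers:
the rank of `F_* A`. It is used for the residue field `k`, where `[k : k^p] = p ^ α(R)`, and for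
a domain `R`, where it is the rank of `F_* R`. -/
noncomputable def frobeniusDegree (p : ℕ) (A : Type*) [CommRing A] [ExpChar A p] : ℕ :=
  Module.finrank A (RestrictScalarsAlong (frobenius A p) A)

section Frobenius

variable {p : ℕ}

theorem iterateFrobenius_succ_eq_comp (A : Type*) [CommRing A] [ExpChar A p] (e : ℕ) :
    iterateFrobenius A p (e + 1) = (frobenius A p).comp (iterateFrobenius A p e) := by
  ext x
  simp only [iterateFrobenius_def, RingHom.comp_apply, frobenius_def, pow_succ, pow_mul]

theorem finrank_restrictScalarsAlong_iterateFrobenius (p e : ℕ) (A : Type*) [CommRing A]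
    [IsDomain A] [ExpChar A p] :
    Module.finrank A (RestrictScalarsAlong (iterateFrobenius A p e) A) =
      frobeniusDegree p A ^ e := by
  induction e with
  | zero =>
    rw [pow_zero, iterateFrobenius_zero]
    exact Module.finrank_self A
  | succ e ih =>
    rw [iterateFrobenius_succ_eq_comp, RestrictScalarsAlong.finrank_comp _ _ (frobenius_inj A p),
      ih, pow_succ, frobeniusDegree]

theorem FrobeniusPushforward.finrank_eq (p e : ℕ) (R : Type u) [CommRing R] [IsDomain R]
    [ExpChar R p] :
    Module.finrank R (FrobeniusPushforward p e R) = frobeniusDegree p R ^ e :=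
  finrank_restrictScalarsAlong_iterateFrobenius p e R

namespace IsFFinite

variable {R : Type u} [CommRing R]

theorem finite_frobenius [ExpChar R p] (h : IsFFinite p R) : (frobenius R p).Finite := by
  rw [← iterateFrobenius_one]
  exact h

theorem of_surjective [ExpChar R p] (h : IsFFinite p R) {S : Type*} [CommRing S] [ExpChar S p]
    (f : R →+* S) (hf : Function.Surjective f) : IsFFinite p S := by
  have hcomm : (frobenius S p).comp f = f.comp (frobenius R p) :=
    RingHom.ext fun x => (f.map_frobenius p x).symm
  have hfinite : (frobenius S p).Finite := by
    refine RingHom.Finite.of_comp_finite (f := f) ?_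
    rw [hcomm]
    exact (RingHom.Finite.of_surjective f hf).comp h.finite_frobenius
  rwa [← iterateFrobenius_one] at hfinite

theorem finite_pushforward [ExpChar R p] (h : IsFFinite p R) (e : ℕ) :
    Module.Finite R (FrobeniusPushforward p e R) := by
  suffices (iterateFrobenius R p e).Finite from this
  induction e with
  | zero =>
    rw [iterateFrobenius_zero]
    exact RingHom.Finite.id R
  | succ e ih =>
    rw [iterateFrobenius_succ_eq_comp]
    exact h.finite_frobenius.comp ih

open IsLocalRing

variable [Fact p.Prime] [IsLocalRing R] [CharP R p]

theorem residueField (h : IsFFinite p R) : IsFFinite p (ResidueField R) :=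
  h.of_surjective _ residue_surjective

theorem frobeniusDegree_residueField_pos (h : IsFFinite p R) :
    0 < frobeniusDegree p (ResidueField R) := by
  have : Module.Finite (ResidueField R)
      (RestrictScalarsAlong (frobenius (ResidueField R) p) (ResidueField R)) :=
    h.residueField.finite_frobenius
  have : Nontrivial (RestrictScalarsAlong (frobenius (ResidueField R) p) (ResidueField R)) :=
    inferInstanceAs (Nontrivial (ResidueField R))
  exact Module.finrank_pos

theorem length_restrictScalarsAlong (h : IsFFinite p R) (e : ℕ) (M : Type*) [AddCommGroup M]
    [Module R M] :
    Module.length R (RestrictScalarsAlong (iterateFrobenius R p e) M) =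
      Module.length R M * (frobeniusDegree p (ResidueField R) ^ e : ℕ) := by
  have : IsLocalHom (iterateFrobenius R p e) :=
    ⟨fun x hx => (isUnit_pow_iff (pow_ne_zero e (Fact.out : p.Prime).ne_zero)).mp
      (by rwa [iterateFrobenius_def] at hx)⟩
  have hmap : ResidueField.map (iterateFrobenius R p e) =
      iterateFrobenius (ResidueField R) p e := by
    ext x
    obtain ⟨x, rfl⟩ := residue_surjective x
    simp only [ResidueField.map_residue, iterateFrobenius_def, map_pow]
  have : Module.Finite (ResidueField R)
      (RestrictScalarsAlong (iterateFrobenius (ResidueField R) p e) (ResidueField R)) :=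
    h.residueField.finite_pushforward e
  rw [RestrictScalarsAlong.length_eq, hmap, Module.length_eq_finrank,
    finrank_restrictScalarsAlong_iterateFrobenius]

end IsFFinite

end Frobenius

namespace FrobeniusPushforward

variable {R : Type u} [CommRing R]

/-- The submodule `F^e_* J` of `F^e_* R` given by an ideal `J`. -/
def ofIdeal (p e : ℕ) [ExpChar R p] (J : Ideal R) : Submodule R (FrobeniusPushforward p e R) where
  carrier := {x | (of p e).symm x ∈ J}
  add_mem' := J.add_mem
  zero_mem' := J.zero_mem
  smul_mem' _ _ hx := J.mul_mem_left _ hx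

theorem mem_ofIdeal {p e : ℕ} [ExpChar R p] {J : Ideal R} {x : FrobeniusPushforward p e R} :
    x ∈ ofIdeal p e J ↔ (of p e).symm x ∈ J := Iff.rfl

theorem ofIdeal_mono (p e : ℕ) [ExpChar R p] {I J : Ideal R} (h : I ≤ J) :
    ofIdeal p e I ≤ ofIdeal p e J := fun _ hx => h hx

theorem length_quotient_ofIdeal {p : ℕ} [Fact p.Prime] [IsLocalRing R] [CharP R p]
    (h : IsFFinite p R) (e : ℕ) (J : Ideal R) :
    Module.length R (FrobeniusPushforward p e R ⧸ ofIdeal p e J) = Module.length R (R ⧸ J) *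
      (frobeniusDegree p (IsLocalRing.ResidueField R) ^ e : ℕ) := by
  let mk : FrobeniusPushforward p e R →ₗ[R]
      RestrictScalarsAlong (iterateFrobenius R p e) (R ⧸ J) :=
    { toFun := Ideal.Quotient.mk J
      map_add' := map_add _
      map_smul' := fun _ _ => rfl }
  have hker : LinearMap.ker mk = ofIdeal p e J :=
    Submodule.ext fun x => Ideal.Quotient.eq_zero_iff_mem (I := J) (a := (of p e).symm x)
  rw [← h.length_restrictScalarsAlong e, ← hker]
  exact (mk.quotKerEquivOfSurjective fun y => Ideal.Quotient.mk_surjective (I := J) y).length_eq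

end FrobeniusPushforward

end RestrictScalars

/-! ### Direct sum decompositions and free summands -/

section DirectSum

variable {R M ι : Type*} [Ring R] [AddCommGroup M] [Module R M] [DecidableEq ι]
  {N : ι → Submodule R M}

theorem internalProj_coeLinearMap (h : DirectSum.IsInternal N) (j : ι)
    (y : DirectSum ι fun i => N i) : internalProj h j (DirectSum.coeLinearMap N y) = y j :=
  congrArg (fun z => z j)
    ((LinearEquiv.ofBijective (DirectSum.coeLinearMap N) h).symm_apply_apply y)

theorem internalProj_coe_same (h : DirectSum.IsInternal N) {j : ι} (x : N j) :
    internalProj h j x = x := by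
  rw [← DirectSum.coeLinearMap_lof (R := R) N, internalProj_coeLinearMap, DirectSum.lof_apply]

theorem internalProj_coe_of_ne (h : DirectSum.IsInternal N) {i j : ι} (hij : i ≠ j) (x : N j) :
    internalProj h i x = 0 := by
  rw [← DirectSum.coeLinearMap_lof (R := R) N, internalProj_coeLinearMap, DirectSum.lof_eq_of,
    DirectSum.of_eq_of_ne _ _ _ hij]

/-- A family of endomorphisms with the formal properties of the projections onto the summands of a
decomposition `M = ⨁ N i`. -/
structure IsProjectionFamily (N : ι → Submodule R M) (P : ι → M →ₗ[R] M) : Prop where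
  apply_mem : ∀ i x, P i x ∈ N i
  apply_of_mem : ∀ i j, ∀ x ∈ N j, P i x = if i = j then x else 0

namespace IsProjectionFamily

variable {P : ι → M →ₗ[R] M}

theorem apply_coeLinearMap (hP : IsProjectionFamily N P) (i : ι) (y : DirectSum ι fun i => N i) :
    P i (DirectSum.coeLinearMap N y) = y i := by
  suffices P i ∘ₗ DirectSum.coeLinearMap N =
      (N i).subtype ∘ₗ DirectSum.component R ι (fun i => N i) i from LinearMap.congr_fun this y
  ext j x
  simp only [LinearMap.comp_apply, DirectSum.coeLinearMap_lof, hP.apply_of_mem i j x x.2,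
    DirectSum.component.of, Submodule.subtype_apply]
  obtain rfl | hij := eq_or_ne j i
  · simp
  · simp [hij, hij.symm]

theorem isInternal [Fintype ι] (hP : IsProjectionFamily N P) (hsum : ∀ x, ∑ i, P i x = x) :
    DirectSum.IsInternal N := by
  constructor
  · refine (injective_iff_map_eq_zero _).mpr fun y hy => DFinsupp.ext fun i => Subtype.ext ?_
    rw [← hP.apply_coeLinearMap]
    exact (congrArg (P i) hy).trans (map_zero _)
  · intro x
    refine ⟨∑ i, DirectSum.lof R ι (fun i => N i) i ⟨P i x, hP.apply_mem i x⟩, ?_⟩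
    change DirectSum.coeLinearMap N _ = x
    simp only [map_sum, DirectSum.coeLinearMap_lof, hsum]

theorem coe_internalProj (hP : IsProjectionFamily N P) (h : DirectSum.IsInternal N) (i : ι)
    (x : M) : (internalProj h i x : M) = P i x := by
  obtain ⟨y, rfl⟩ := h.2 x
  exact (congrArg Subtype.val (internalProj_coeLinearMap h i y)).trans
    (hP.apply_coeLinearMap i y).symm

end IsProjectionFamily

end DirectSum

section Biorthogonal

variable {R M ι : Type*} [CommRing R] [AddCommGroup M] [Module R M]

/-- A family of linear forms together with a family of vectors dual to it: `φ i (v j) = δ_ij`. Such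
families of length `n` correspond to free direct summands of rank `n` with a chosen basis. -/
def IsBiorthogonal [DecidableEq ι] (φ : ι → M →ₗ[R] R) (v : ι → M) : Prop :=
  ∀ i j, φ i (v j) = if i = j then 1 else 0

namespace IsBiorthogonal

section

variable [DecidableEq ι] {φ : ι → M →ₗ[R] R} {v : ι → M}

theorem apply_same (h : IsBiorthogonal φ v) (i : ι) : φ i (v i) = 1 :=
  (h i i).trans (if_pos rfl)

theorem apply_sum_smul [Fintype ι] (h : IsBiorthogonal φ v) (c : ι → R) (i : ι) :
    φ i (∑ j, c j • v j) = c i := by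
  simp [h i _]

theorem apply_sub_sum_smul [Fintype ι] (h : IsBiorthogonal φ v) (x : M) (i : ι) :
    φ i (x - ∑ j, φ j x • v j) = 0 := by
  rw [map_sub, h.apply_sum_smul, sub_self]

theorem linearIndependent [Finite ι] (h : IsBiorthogonal φ v) : LinearIndependent R v := by
  cases nonempty_fintype ι
  exact Fintype.linearIndependent_iff.mpr fun c hc i => by
    rw [← h.apply_sum_smul c i, hc, map_zero]

end

variable {n : ℕ} {φ : Fin n → M →ₗ[R] R} {v : Fin n → M}

theorem cons (h : IsBiorthogonal φ v) {ψ : M →ₗ[R] R} {y : M} (hψ : ∀ i, ψ (v i) = 0)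
    (hy : ∀ i, φ i y = 0) (hψy : ψ y = 1) :
    IsBiorthogonal (Fin.cons ψ φ : Fin (n + 1) → M →ₗ[R] R) (Fin.cons y v) := by
  intro i j
  cases i using Fin.cases <;> cases j using Fin.cases <;>
    simp [hψ, hy, hψy, h _ _, (Fin.succ_ne_zero _).symm]

/-- The summands `⋂ ker φ i`, `R v 0`, …, `R v (n - 1)` of `M` given by a biorthogonal family. -/
def summand (φ : Fin n → M →ₗ[R] R) (v : Fin n → M) : Fin (n + 1) → Submodule R M :=
  Fin.cons (⨅ i, LinearMap.ker (φ i)) fun i => Submodule.span R {v i}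

/-- The projections of `M` onto the submodules `summand φ v`. -/
def projection (φ : Fin n → M →ₗ[R] R) (v : Fin n → M) : Fin (n + 1) → M →ₗ[R] M :=
  Fin.cons (LinearMap.id - ∑ i, (φ i).smulRight (v i)) fun i => (φ i).smulRight (v i)

theorem isProjectionFamily (h : IsBiorthogonal φ v) :
    IsProjectionFamily (summand φ v) (projection φ v) where
  apply_mem i x := by
    cases i using Fin.cases with
    | zero =>
      simp [summand, projection, Submodule.mem_iInf, h _ _]
    | succ i =>
      exact Submodule.smul_mem _ _ (Submodule.mem_span_singleton_self _)
  apply_of_mem i j x hx := by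
    cases j using Fin.cases with
    | zero =>
      have hker : ∀ i, φ i x = 0 := (Submodule.mem_iInf _).mp hx
      cases i using Fin.cases <;> simp [projection, hker]
    | succ j =>
      obtain ⟨r, rfl⟩ := Submodule.mem_span_singleton.mp hx
      cases i using Fin.cases with
      | zero => simp [projection, h _ _, (Fin.succ_ne_zero j).symm]
      | succ i =>
        simp only [projection, Fin.cons_succ, LinearMap.smulRight_apply, map_smul, h i j,
          Fin.succ_inj]
        split_ifs with hij <;> simp [hij]

theorem isInternal (h : IsBiorthogonal φ v) : DirectSum.IsInternal (summand φ v) :=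
  h.isProjectionFamily.isInternal fun x => by
    simp [Fin.sum_univ_succ, projection]

theorem exists_linearEquiv_summand (h : IsBiorthogonal φ v) (i : Fin n) :
    ∃ f : summand φ v i.succ ≃ₗ[R] R, f.toLinearMap ∘ₗ internalProj h.isInternal i.succ = φ i := by
  have hbijective : Function.Bijective (φ i ∘ₗ (summand φ v i.succ).subtype) := by
    refine ⟨(injective_iff_map_eq_zero _).mpr fun w hw => Subtype.ext ?_, fun r =>
      ⟨⟨r • v i, Submodule.smul_mem _ _ (Submodule.mem_span_singleton_self _)⟩, ?_⟩⟩
    · obtain ⟨r, hr⟩ := Submodule.mem_span_singleton.mp w.2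
      rw [LinearMap.comp_apply, Submodule.subtype_apply, ← hr, map_smul, h.apply_same, smul_eq_mul,
        mul_one] at hw
      rw [← hr, hw, zero_smul, Submodule.coe_zero]
    · simp [h.apply_same]
  refine ⟨LinearEquiv.ofBijective _ hbijective, LinearMap.ext fun x => ?_⟩
  change φ i (internalProj h.isInternal i.succ x) = φ i x
  rw [h.isProjectionFamily.coe_internalProj]
  simp [projection, h.apply_same]

end IsBiorthogonal

end Biorthogonal

/-! ### Free summands over a local ring -/

section SplittingSubmodule

open IsLocalRing

variable {R M : Type*} [CommRing R] [IsLocalRing R] [AddCommGroup M] [Module R M]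

/-- The elements of `M` that every linear form in `D` maps into the maximal ideal, that is, those
that no linear form in `D` splits off as a free summand. -/
def splittingSubmodule (D : Submodule R (Module.Dual R M)) : Submodule R M :=
  ⨅ φ ∈ D, Submodule.comap φ (maximalIdeal R)

variable {D : Submodule R (Module.Dual R M)}

theorem mem_splittingSubmodule {x : M} :
    x ∈ splittingSubmodule D ↔ ∀ φ ∈ D, φ x ∈ maximalIdeal R := by
  simp only [splittingSubmodule, Submodule.mem_iInf, Submodule.mem_comap]

/-- The reduction modulo the maximal ideal of the values of a family of linear forms. -/
noncomputable def residualForms {ι : Type*} (φ : ι → Module.Dual R M) :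
    M →ₗ[R] ι → ResidueField R :=
  LinearMap.pi fun i => Algebra.linearMap R (ResidueField R) ∘ₗ φ i

theorem mem_ker_residualForms {ι : Type*} {φ : ι → Module.Dual R M} {x : M} :
    x ∈ LinearMap.ker (residualForms φ) ↔ ∀ i, φ i x ∈ maximalIdeal R :=
  funext_iff.trans (forall_congr' fun _ => residue_eq_zero_iff _)

theorem length_pi_residueField (R : Type*) [CommRing R] [IsLocalRing R] (ι : Type*) [Fintype ι] :
    Module.length R (ι → ResidueField R) = Fintype.card ι := by
  have : IsSimpleModule R (ResidueField R) :=
    isSimpleModule_iff_quot_maximal.mpr ⟨_, maximalIdeal.isMaximal R, ⟨LinearEquiv.refl _ _⟩⟩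
  simp [Module.length_pi_of_fintype]

theorem splittingSubmodule_le_ker_residualForms {ι : Type*} {φ : ι → Module.Dual R M}
    (hφ : ∀ i, φ i ∈ D) : splittingSubmodule D ≤ LinearMap.ker (residualForms φ) := fun _ hx =>
  mem_ker_residualForms.mpr fun i => mem_splittingSubmodule.mp hx _ (hφ i)

namespace IsBiorthogonal

section

variable {ι : Type*} [DecidableEq ι] {φ : ι → Module.Dual R M} {v : ι → M}

theorem residualForms_surjective [Finite ι] (h : IsBiorthogonal φ v) :
    Function.Surjective (residualForms φ) := by
  cases nonempty_fintype ι
  intro c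
  choose b hb using fun i => residue_surjective (c i)
  refine ⟨∑ j, b j • v j, funext fun i => ?_⟩
  rw [← hb i, ← h.apply_sum_smul b i]
  rfl

theorem card_le_length [Fintype ι] (h : IsBiorthogonal φ v) (hφ : ∀ i, φ i ∈ D) :
    (Fintype.card ι : ℕ∞) ≤ Module.length R (M ⧸ splittingSubmodule D) := by
  rw [← length_pi_residueField R]
  refine Module.length_le_of_surjective
    (Submodule.liftQ _ _ (splittingSubmodule_le_ker_residualForms hφ)) ?_
  rw [← LinearMap.range_eq_top, Submodule.range_liftQ, LinearMap.range_eq_top]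
  exact h.residualForms_surjective

theorem length_eq_card [Fintype ι] (h : IsBiorthogonal φ v) (hφ : ∀ i, φ i ∈ D)
    (hmax : ∀ x, x - ∑ i, φ i x • v i ∈ splittingSubmodule D) :
    Module.length R (M ⧸ splittingSubmodule D) = Fintype.card ι := by
  refine le_antisymm ?_ (h.card_le_length hφ)
  have hker : LinearMap.ker (residualForms φ) ≤ splittingSubmodule D := by
    intro x hx
    refine mem_splittingSubmodule.mpr fun ψ hψ => ?_
    rw [← sub_add_cancel x (∑ i, φ i x • v i), map_add, map_sum]
    refine add_mem (mem_splittingSubmodule.mp (hmax x) ψ hψ) (sum_mem fun i _ => ?_)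
    rw [map_smul]
    exact Ideal.mul_mem_right _ _ (mem_ker_residualForms.mp hx i)
  rw [← length_pi_residueField R]
  exact Module.length_le_of_injective
    (Submodule.liftQ _ _ (splittingSubmodule_le_ker_residualForms hφ))
    (LinearMap.ker_eq_bot.mp (Submodule.ker_liftQ_eq_bot _ _ _ hker))

end

theorem exists_cons {n : ℕ} {φ : Fin n → Module.Dual R M} {v : Fin n → M}
    (h : IsBiorthogonal φ v) (hφ : ∀ i, φ i ∈ D) {x : M}
    (hx : x - ∑ i, φ i x • v i ∉ splittingSubmodule D) :
    ∃ (ψ : Module.Dual R M) (y : M), ψ ∈ D ∧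
      IsBiorthogonal (Fin.cons ψ φ : Fin (n + 1) → Module.Dual R M) (Fin.cons y v) := by
  simp only [mem_splittingSubmodule, not_forall] at hx
  obtain ⟨ψ, hψ, hunit⟩ := hx
  obtain ⟨w, hw⟩ := (notMem_maximalIdeal.mp hunit).exists_left_inv
  refine ⟨w • (ψ - ∑ i, ψ (v i) • φ i), x - ∑ i, φ i x • v i,
    D.smul_mem w (D.sub_mem hψ (D.sum_mem fun i _ => D.smul_mem _ (hφ i))),
    h.cons (fun i => ?_) (h.apply_sub_sum_smul x) ?_⟩
  · simp [LinearMap.sum_apply, h _ _]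
  · simp only [LinearMap.smul_apply, LinearMap.sub_apply, LinearMap.sum_apply,
      h.apply_sub_sum_smul, smul_eq_mul, mul_zero, Finset.sum_const_zero, sub_zero, hw]

end IsBiorthogonal

theorem exists_isBiorthogonal_length_eq (D : Submodule R (Module.Dual R M))
    (hfinite : Module.length R (M ⧸ splittingSubmodule D) ≠ ⊤) :
    ∃ (n : ℕ) (φ : Fin n → Module.Dual R M) (v : Fin n → M), (∀ i, φ i ∈ D) ∧
      IsBiorthogonal φ v ∧ Module.length R (M ⧸ splittingSubmodule D) = n := by
  by_contra! hne
  have hexists : ∀ n : ℕ, ∃ (φ : Fin n → Module.Dual R M) (v : Fin n → M), (∀ i, φ i ∈ D) ∧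
      IsBiorthogonal φ v := by
    intro n
    induction n with
    | zero => exact ⟨finZeroElim, finZeroElim, finZeroElim, finZeroElim⟩
    | succ n ih =>
      obtain ⟨φ, v, hφ, h⟩ := ih
      obtain ⟨x, hx⟩ : ∃ x, x - ∑ i, φ i x • v i ∉ splittingSubmodule D := by
        by_contra! hmax
        exact hne n φ v hφ h (by simpa using h.length_eq_card hφ hmax)
      obtain ⟨ψ, y, hψ, hcons⟩ := h.exists_cons hφ hx
      exact ⟨_, _, Fin.cases hψ hφ, hcons⟩
  obtain ⟨l, hl⟩ := ENat.ne_top_iff_exists.mp hfinite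
  obtain ⟨φ, v, hφ, h⟩ := hexists (l + 1)
  have hle := h.card_le_length hφ
  rw [← hl, Fintype.card_fin] at hle
  exact absurd (Nat.cast_le.mp hle) l.lt_succ_self.not_ge

end SplittingSubmodule

/-! ### Splitting ideals -/

namespace FrobeniusPushforward

/-- The multiplication of `R`, as an `R`-bilinear map on `F^e_* R`. -/
def mul (p e : ℕ) (R : Type u) [CommRing R] [ExpChar R p] :
    FrobeniusPushforward p e R →ₗ[R] FrobeniusPushforward p e R →ₗ[R] FrobeniusPushforward p e R :=
  LinearMap.mk₂ R (fun x y => of p e ((of p e).symm x * (of p e).symm y))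
    (fun x x' y => by simp only [map_add, add_mul])
    (fun r x y => congrArg (of p e) (mul_assoc (r ^ p ^ e) _ _))
    (fun x y y' => by simp only [map_add, mul_add])
    (fun r x y => congrArg (of p e) (mul_left_comm _ (r ^ p ^ e) _))

end FrobeniusPushforward

namespace CartierMap

variable {p e : ℕ} {R : Type u} [CommRing R] [ExpChar R p]

theorem map_pow_mul (φ : CartierMap p e R) (r x : R) :
    φ (.of p e (r ^ p ^ e * x)) = r * φ (.of p e x) := by
  rw [← FrobeniusPushforward.smul_of, map_smul, smul_eq_mul]

/-- Multiplication by `s`, as a `p^0`-linear map. -/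
def mulLeft (p : ℕ) {R : Type u} [CommRing R] [ExpChar R p] (s : R) : CartierMap p 0 R where
  toFun x := s * (FrobeniusPushforward.of p 0).symm x
  map_add' x y := by rw [map_add, mul_add]
  map_smul' r x := by
    obtain ⟨x, rfl⟩ := (FrobeniusPushforward.of p 0).surjective x
    rw [FrobeniusPushforward.smul_of, AddEquiv.symm_apply_apply, AddEquiv.symm_apply_apply,
      pow_zero, pow_one, RingHom.id_apply, smul_eq_mul, mul_left_comm]

/-- The bilinear form `(x, y) ↦ φ (x y)` on `F^e_* R`. -/
def pairing (φ : CartierMap p e R) :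
    FrobeniusPushforward p e R →ₗ[R] Module.Dual R (FrobeniusPushforward p e R) :=
  (FrobeniusPushforward.mul p e R).compr₂ φ

/-- The `R`-linear map `F^{e' + e}_* R → F^{e'}_* R` induced by `φ : F^e_* R → R`. -/
def pushforward (e' : ℕ) (φ : CartierMap p e R) :
    FrobeniusPushforward p (e' + e) R →ₗ[R] FrobeniusPushforward p e' R where
  toFun x := .of p e' (φ (.of p e ((FrobeniusPushforward.of p (e' + e)).symm x)))
  map_add' x y := by simp only [map_add]
  map_smul' r x := by
    obtain ⟨x, rfl⟩ := (FrobeniusPushforward.of p (e' + e)).surjective x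
    rw [FrobeniusPushforward.smul_of, AddEquiv.symm_apply_apply, AddEquiv.symm_apply_apply,
      pow_add, pow_mul, map_pow_mul, RingHom.id_apply, FrobeniusPushforward.smul_of]

end CartierMap

namespace CartierSubalgebra

section Ring

variable {p : ℕ} {R : Type u} [CommRing R] [ExpChar R p] (D : CartierSubalgebra p R)

theorem mem_component_of_forall_eq {e e' : ℕ} (h : e' = e) {ψ : CartierMap p e' R}
    (hψ : ψ ∈ D.component e') {φ : CartierMap p e R}
    (heq : ∀ x : R, φ (.of p e x) = ψ (.of p e' x)) : φ ∈ D.component e := by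
  subst h
  exact (LinearMap.ext heq : φ = ψ) ▸ hψ

theorem mulLeft_mem_component (s : R) : CartierMap.mulLeft p s ∈ D.component 0 :=
  D.component_zero ▸ AddSubgroup.mem_top _

/-- The component `D_e`, as an `R`-submodule of `Hom_R(F^e_* R, R)`. -/
def componentSubmodule (e : ℕ) : Submodule R (Module.Dual R (FrobeniusPushforward p e R)) where
  toAddSubmonoid := (D.component e).toAddSubmonoid
  smul_mem' s _ hφ := D.mem_component_of_forall_eq (zero_add e)
    (D.mul_mem (D.mulLeft_mem_component s) hφ) fun _ => rfl

variable {D}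

theorem pairing_mem_component {e : ℕ} {φ : CartierMap p e R} (hφ : φ ∈ D.component e)
    (x : FrobeniusPushforward p e R) : φ.pairing x ∈ D.component e :=
  D.mem_component_of_forall_eq (add_zero e)
    (D.mul_mem hφ (D.mulLeft_mem_component ((FrobeniusPushforward.of p e).symm x))) fun _ => rfl

theorem exists_isBiorthogonal_of_isInternal {e n : ℕ}
    {N : Fin n → Submodule R (FrobeniusPushforward p e R)} (h : DirectSum.IsInternal N) :
    ∃ (φ : {j // D.IsSummand h j} → CartierMap p e R)
      (v : {j // D.IsSummand h j} → FrobeniusPushforward p e R),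
      (∀ j, φ j ∈ D.component e) ∧ IsBiorthogonal φ v := by
  choose f hf using fun j : {j // D.IsSummand h j} => j.2
  refine ⟨fun j => (f j).toLinearMap ∘ₗ internalProj h j, fun j => (f j).symm 1, hf,
    fun i j => ?_⟩
  obtain rfl | hij := eq_or_ne i j
  · simp [internalProj_coe_same]
  · simp [internalProj_coe_of_ne h (Subtype.coe_ne_coe.mpr hij), hij]

theorem le_ncard_isSummand {e n : ℕ} {φ : Fin n → CartierMap p e R}
    {v : Fin n → FrobeniusPushforward p e R} (h : IsBiorthogonal φ v)
    (hφ : ∀ i, φ i ∈ D.component e) : n ≤ {j | D.IsSummand h.isInternal j}.ncard :=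
  calc n = (Set.range (Fin.succ : Fin n → Fin (n + 1))).ncard := by
        rw [← Set.image_univ, Set.ncard_image_of_injective _ (Fin.succ_injective n),
          Set.ncard_univ, Nat.card_fin]
    _ ≤ _ := Set.ncard_le_ncard (Set.range_subset_iff.mpr fun i =>
        (h.exists_linearEquiv_summand i).imp fun _ hf => hf ▸ hφ i) (Set.toFinite _)

end Ring

section LocalRing

open IsLocalRing

variable {p : ℕ} {R : Type u} [CommRing R] [IsLocalRing R] [ExpChar R p]

/-- The splitting ideal `I_e` of `(R, D)`. -/
def splittingIdeal (D : CartierSubalgebra p R) (e : ℕ) : Ideal R where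
  carrier := {r | ∀ φ ∈ D.component e, φ (.of p e r) ∈ maximalIdeal R}
  add_mem' hx hy φ hφ := by
    rw [map_add, map_add]
    exact add_mem (hx φ hφ) (hy φ hφ)
  zero_mem' φ _ := by
    rw [map_zero, map_zero]
    exact zero_mem _
  smul_mem' s _ hr φ hφ := hr (φ.pairing (.of p e s)) (pairing_mem_component hφ _)

variable {D : CartierSubalgebra p R}

theorem mem_splittingIdeal {e : ℕ} {r : R} :
    r ∈ D.splittingIdeal e ↔ ∀ φ ∈ D.component e, φ (.of p e r) ∈ maximalIdeal R := Iff.rfl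

theorem ofIdeal_splittingIdeal (e : ℕ) : FrobeniusPushforward.ofIdeal p e (D.splittingIdeal e) =
    splittingSubmodule (D.componentSubmodule e) :=
  Submodule.ext fun _ => (mem_splittingSubmodule (D := D.componentSubmodule e)).symm

theorem pow_mem_splittingIdeal (e : ℕ) {x : R} (hx : x ∈ maximalIdeal R) :
    x ^ p ^ e ∈ D.splittingIdeal e :=
  mem_splittingIdeal.mpr fun φ _ => by
    rw [← mul_one (x ^ p ^ e), φ.map_pow_mul]
    exact Ideal.mul_mem_right _ _ hx

theorem map_mem_splittingIdeal {e e' : ℕ} {φ : CartierMap p e' R} (hφ : φ ∈ D.component e') {r : R}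
    (hr : r ∈ D.splittingIdeal (e + e')) : φ (.of p e' r) ∈ D.splittingIdeal e :=
  mem_splittingIdeal.mpr fun ψ hψ => mem_splittingIdeal.mp hr (ψ.mul φ) (D.mul_mem hψ hφ)

theorem splittingNumber_eq_of_isBiorthogonal {e n : ℕ} {φ : Fin n → CartierMap p e R}
    {v : Fin n → FrobeniusPushforward p e R} (h : IsBiorthogonal φ v)
    (hφ : ∀ i, φ i ∈ D.component e) (hn : Module.length R
      (FrobeniusPushforward p e R ⧸ splittingSubmodule (D.componentSubmodule e)) = n) :
    D.splittingNumber e = n := by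
  have hub : n ∈ upperBounds {a : ℕ | ∃ (m : ℕ)
      (N : Fin m → Submodule R (FrobeniusPushforward p e R)) (h : DirectSum.IsInternal N),
      a = {j : Fin m | D.IsSummand h j}.ncard} := by
    rintro _ ⟨m, N, hN, rfl⟩
    classical
    obtain ⟨φ', v', hφ', h'⟩ := exists_isBiorthogonal_of_isInternal (D := D) hN
    have hle := h'.card_le_length (D := D.componentSubmodule e) hφ'
    rwa [hn, Nat.cast_le, ← Nat.card_eq_fintype_card] at hle
  exact le_antisymm (csSup_le ⟨_, _, _, h.isInternal, rfl⟩ hub)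
    ((le_ncard_isSummand h hφ).trans (le_csSup ⟨n, hub⟩ ⟨_, _, h.isInternal, rfl⟩))

end LocalRing

end CartierSubalgebra

/-! ### Splitting numbers and their semigroup -/

/-- The number `p ^ (d + α(R))`, where `d` stands for the dimension of `R`: the length of
`F^e_* (R / I)` grows at most like its `e`-th power. -/
noncomputable def frobeniusGrowth (p d : ℕ) (R : Type*) [CommRing R] [IsLocalRing R] [Fact p.Prime]
    [CharP R p] : ℕ :=
  p ^ d * frobeniusDegree p (IsLocalRing.ResidueField R)

namespace CartierSubalgebra

section FFinite

open IsLocalRing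

variable {p : ℕ} [Fact p.Prime] {R : Type u} [CommRing R] [IsLocalRing R] [IsNoetherianRing R]
  [CharP R p] {d : ℕ} {D : CartierSubalgebra p R}

theorem exists_length_quotient_splittingIdeal_le (hd : ringKrullDim R ≤ d)
    (D : CartierSubalgebra p R) :
    ∃ C : ℕ, ∀ e, Module.length R (R ⧸ D.splittingIdeal e) ≤ (C * (p ^ e) ^ d : ℕ) := by
  obtain ⟨C, hC⟩ := exists_length_quotient_le_mul_pow (⊥ : Ideal R)
    ((RingEquiv.quotientBot R).ringKrullDim.trans_le hd)
  exact ⟨C, fun e => hC _ _ (pow_pos (Fact.out : p.Prime).pos e) bot_le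
    fun _ => pow_mem_splittingIdeal e⟩

theorem length_quotient_splittingIdeal_ne_top (D : CartierSubalgebra p R) (e : ℕ) :
    Module.length R (R ⧸ D.splittingIdeal e) ≠ ⊤ := by
  obtain ⟨C, hC⟩ :=
    exists_length_quotient_splittingIdeal_le (ringKrullDim_le_spanFinrank_maximalIdeal R) D
  exact ne_top_of_le_ne_top (ENat.natCast_ne_top _) (hC e)

theorem exists_isBiorthogonal_splittingNumber (hR : IsFFinite p R) (D : CartierSubalgebra p R)
    (e : ℕ) :
    ∃ (φ : Fin (D.splittingNumber e) → CartierMap p e R)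
      (v : Fin (D.splittingNumber e) → FrobeniusPushforward p e R),
      (∀ i, φ i ∈ D.component e) ∧ IsBiorthogonal φ v ∧
      Module.length R (FrobeniusPushforward p e R ⧸ splittingSubmodule (D.componentSubmodule e)) =
        D.splittingNumber e := by
  obtain ⟨n, φ, v, hφ, h, hn⟩ := exists_isBiorthogonal_length_eq (D.componentSubmodule e) (by
    rw [← ofIdeal_splittingIdeal, FrobeniusPushforward.length_quotient_ofIdeal hR]
    exact WithTop.mul_ne_top (D.length_quotient_splittingIdeal_ne_top e) (ENat.natCast_ne_top _))
  obtain rfl := splittingNumber_eq_of_isBiorthogonal h hφ hn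
  exact ⟨φ, v, hφ, h, hn⟩

theorem splittingNumber_eq_length_mul (hR : IsFFinite p R) (D : CartierSubalgebra p R) (e : ℕ) :
    (D.splittingNumber e : ℕ∞) =
      Module.length R (R ⧸ D.splittingIdeal e) * (frobeniusDegree p (ResidueField R) ^ e : ℕ) := by
  obtain ⟨-, -, -, -, h⟩ := D.exists_isBiorthogonal_splittingNumber hR e
  rw [← h, ← ofIdeal_splittingIdeal, FrobeniusPushforward.length_quotient_ofIdeal hR]

theorem exists_splittingNumber_le (hR : IsFFinite p R) (hd : ringKrullDim R ≤ d)
    (D : CartierSubalgebra p R) :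
    ∃ C : ℕ, ∀ e, D.splittingNumber e ≤ C * frobeniusGrowth p d R ^ e := by
  obtain ⟨C, hC⟩ := exists_length_quotient_splittingIdeal_le hd D
  refine ⟨C, fun e => ?_⟩
  have hle : (D.splittingNumber e : ℕ∞) ≤
      (C * (p ^ e) ^ d : ℕ) * (frobeniusDegree p (ResidueField R) ^ e : ℕ) := by
    rw [splittingNumber_eq_length_mul hR]
    gcongr
    exact hC e
  rw [frobeniusGrowth, mul_pow, pow_right_comm, ← mul_assoc]
  exact_mod_cast hle

theorem mem_semigroup_iff (hR : IsFFinite p R) {e : ℕ} :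
    e ∈ D.semigroup ↔ ∃ φ ∈ D.component e, ∃ x, φ x = 1 := by
  obtain ⟨φ, v, hφ, h, hlength⟩ := D.exists_isBiorthogonal_splittingNumber hR e
  constructor
  · intro he
    let i : Fin (D.splittingNumber e) := ⟨0, Nat.pos_of_ne_zero he⟩
    exact ⟨φ i, hφ i, v i, h.apply_same i⟩
  · rintro ⟨ψ, hψ, x, hx⟩ he
    have hle := IsBiorthogonal.card_le_length (ι := Unit) (D := D.componentSubmodule e)
      (φ := fun _ => ψ) (v := fun _ => x) (fun _ _ => by simp [hx]) fun _ => hψ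
    rw [hlength, he] at hle
    simp at hle

theorem zero_mem_semigroup (hR : IsFFinite p R) (D : CartierSubalgebra p R) : 0 ∈ D.semigroup :=
  (mem_semigroup_iff hR).mpr
    ⟨.mulLeft p 1, D.mulLeft_mem_component 1, .of p 0 1, one_mul 1⟩

theorem add_mem_semigroup (hR : IsFFinite p R) {e e' : ℕ} (h : e ∈ D.semigroup)
    (h' : e' ∈ D.semigroup) : e + e' ∈ D.semigroup := by
  obtain ⟨φ, hφ, x, hx⟩ := (mem_semigroup_iff hR).mp h
  obtain ⟨ψ, hψ, y, hy⟩ := (mem_semigroup_iff hR).mp h'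
  refine (mem_semigroup_iff hR).mpr ⟨φ.mul ψ, D.mul_mem hφ hψ, .of p (e + e')
    ((FrobeniusPushforward.of p e).symm x ^ p ^ e' * (FrobeniusPushforward.of p e').symm y), ?_⟩
  change φ (.of p e (ψ (.of p e' (_ * _)))) = 1
  rw [ψ.map_pow_mul, AddEquiv.apply_symm_apply, hy, mul_one, AddEquiv.apply_symm_apply, hx]

theorem exists_mem_semigroup_of_ge (hR : IsFFinite p R) (D : CartierSubalgebra p R) :
    ∃ n₀, ∀ m ≥ n₀, D.semigroupIndex ∣ m → m ∈ D.semigroup := by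
  obtain ⟨n₀, h⟩ := Nat.exists_mem_closure_of_ge D.semigroup
  let Γ : AddSubmonoid ℕ :=
    { carrier := D.semigroup
      add_mem' := add_mem_semigroup hR
      zero_mem' := D.zero_mem_semigroup hR }
  exact ⟨n₀, fun m hm hdvd => AddSubmonoid.closure_le.mpr (le_refl (Γ : Set ℕ)) (h m hm hdvd)⟩

theorem infinite_semigroup (hR : IsFFinite p R) (hn : D.semigroupIndex ≠ 0) :
    D.semigroup.Infinite := by
  obtain ⟨n₀, hn₀⟩ := D.exists_mem_semigroup_of_ge hR
  refine Set.infinite_of_injective_forall_mem (f := fun m => (n₀ + m) * D.semigroupIndex)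
    (fun a b hab => by simpa [hn] using hab) fun m => hn₀ _ ?_ (dvd_mul_left _ _)
  exact (Nat.le_add_right _ _).trans (Nat.le_mul_of_pos_right _ (Nat.pos_of_ne_zero hn))

theorem isReduced_of_mem_semigroup (hR : IsFFinite p R) {e : ℕ} (he : e ≠ 0)
    (h : e ∈ D.semigroup) : IsReduced R := by
  obtain ⟨φ, -, x, hx⟩ := (mem_semigroup_iff hR).mp h
  refine (isReduced_iff_pow_one_lt (p ^ e) (Nat.one_lt_pow he (Fact.out : p.Prime).one_lt)).mpr
    fun y hy => ?_
  have hmul := φ.map_pow_mul y ((FrobeniusPushforward.of p e).symm x)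
  rwa [hy, zero_mul, map_zero, map_zero, AddEquiv.apply_symm_apply, hx, mul_one, eq_comm] at hmul

end FFinite

end CartierSubalgebra

/-! ### Domains -/

section Pairing

variable {R M : Type*} [CommRing R] [AddCommGroup M] [Module R M]

theorem exists_smul_mem_span_of_finrank_le [Nontrivial R] [Module.Finite R M] {n : ℕ}
    {x : Fin n → M} (hx : LinearIndependent R x) (hn : Module.finrank R M ≤ n) (y : M) :
    ∃ a : R, a ≠ 0 ∧ a • y ∈ Submodule.span R (Set.range x) := by
  by_contra! h
  have hcons : LinearIndependent R (Fin.cons y x : Fin (n + 1) → M) := by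
    refine hx.finCons' y x fun c w hw hcw => ?_
    by_contra hc
    refine h c hc ?_
    rw [eq_neg_of_add_eq_zero_left hcw]
    exact neg_mem hw
  have hcard := hcons.fintype_card_le_finrank
  rw [Fintype.card_fin] at hcard
  omega

variable [IsDomain R] [Module.Finite R M] {B : M →ₗ[R] Module.Dual R M}

theorem det_pairing_ne_zero (hB : Function.Injective B) {n : ℕ} {x : Fin n → M}
    (hx : LinearIndependent R x) (hn : Module.finrank R M ≤ n) :
    (Matrix.of fun i j => B (x i) (x j)).det ≠ 0 := by
  intro hdet
  obtain ⟨c, hc, hcB⟩ := Matrix.exists_vecMul_eq_zero_iff.mpr hdet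
  have hx0 (j : Fin n) : B (∑ i, c i • x i) (x j) = 0 := by
    simpa [Matrix.vecMul, dotProduct] using congrFun hcB j
  have hspan : Submodule.span R (Set.range x) ≤ LinearMap.ker (B (∑ i, c i • x i)) :=
    Submodule.span_le.mpr (Set.range_subset_iff.mpr hx0)
  have hzero : B (∑ i, c i • x i) = 0 := by
    ext y
    obtain ⟨a, ha, hay⟩ := exists_smul_mem_span_of_finrank_le hx hn y
    simpa [ha] using hspan hay
  exact hc (funext (Fintype.linearIndependent_iff.mp hx c
    ((map_eq_zero_iff B hB).mp hzero)))

/-- By Cramer's rule, the determinant of the Gram matrix of a maximal linearly independent family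
can serve as `z`. -/
theorem exists_forall_exists_pairing_eq_mul (hB : Function.Injective B) :
    ∃ (x : Fin (Module.finrank R M) → M) (z : R), z ≠ 0 ∧
      ∀ c : Fin (Module.finrank R M) → R, ∃ y, ∀ i, B (x i) y = z * c i := by
  obtain ⟨x, hx⟩ := exists_linearIndependent_of_le_finrank (le_refl (Module.finrank R M))
  let G := Matrix.of fun i j => B (x i) (x j)
  refine ⟨x, G.det, det_pairing_ne_zero hB hx le_rfl, fun c =>
    ⟨∑ j, G.adjugate.mulVec c j • x j, fun i => ?_⟩⟩
  have hcramer : G.mulVec (G.adjugate.mulVec c) = G.det • c := by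
    rw [Matrix.mulVec_mulVec, Matrix.mul_adjugate, Matrix.smul_mulVec, Matrix.one_mulVec]
  calc B (x i) (∑ j, G.adjugate.mulVec c j • x j)
      = G.mulVec (G.adjugate.mulVec c) i := by
        simp [Matrix.mulVec, dotProduct, G, mul_comm]
    _ = G.det * c i := congrFun hcramer i

end Pairing

theorem card_mul_length_quotient_le {R M M' ι : Type*} [CommRing R] [AddCommGroup M] [Module R M]
    [AddCommGroup M'] [Module R M'] [Fintype ι] {K K' : Submodule R M} (hK : K ≤ K')
    {N : Submodule R M'} {Ψ : ι → M' →ₗ[R] M} (hN : ∀ i, ∀ x ∈ N, Ψ i x ∈ K)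
    (hK' : ∀ w : ι → M, (∀ i, w i ∈ K') → ∃ x, ∀ i, w i - Ψ i x ∈ K) :
    Fintype.card ι * Module.length R (M ⧸ K) ≤
      Module.length R (M' ⧸ N) + Fintype.card ι * Module.length R (M ⧸ K') := by
  let F : M' ⧸ N →ₗ[R] ι → M ⧸ K := N.liftQ (LinearMap.pi fun i => K.mkQ ∘ₗ Ψ i) fun x hx =>
    funext fun i => (Submodule.Quotient.mk_eq_zero K).mpr (hN i x hx)
  let Q : (ι → M ⧸ K) →ₗ[R] ι → M ⧸ K' :=
    LinearMap.pi fun i => Submodule.factor hK ∘ₗ LinearMap.proj i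
  have hker : LinearMap.ker Q ≤ LinearMap.range F := by
    intro w hw
    choose y hy using fun i => K.mkQ_surjective (w i)
    obtain rfl : (fun i => K.mkQ (y i)) = w := funext hy
    obtain ⟨x, hx⟩ := hK' y fun i => (Submodule.Quotient.mk_eq_zero K').mp (congrFun hw i)
    exact ⟨N.mkQ x, funext fun i => ((Submodule.Quotient.eq K).mpr (hx i)).symm⟩
  simpa [Module.length_pi_of_fintype] using length_le_add_of_ker_le_range F Q hker

theorem CartierMap.pairing_injective {p e : ℕ} {R : Type u} [CommRing R] [IsDomain R] [ExpChar R p]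
    {φ : CartierMap p e R} (hφ : φ ≠ 0) : Function.Injective φ.pairing := by
  refine (injective_iff_map_eq_zero _).mpr fun x hx => ?_
  obtain ⟨s, rfl⟩ := (FrobeniusPushforward.of p e).surjective x
  by_contra hs
  refine hφ (LinearMap.ext fun y => ?_)
  obtain ⟨y, rfl⟩ := (FrobeniusPushforward.of p e).surjective y
  have hzero : s * φ (.of p e y) = 0 := by
    rw [← φ.map_pow_mul, ← mul_pow_sub_one (expChar_pow_pos R p e).ne', mul_assoc]
    exact LinearMap.congr_fun hx (.of p e (s ^ (p ^ e - 1) * y))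
  exact (mul_eq_zero.mp hzero).resolve_left fun h => hs (by rw [h, map_zero])

namespace CartierSubalgebra

theorem card_mul_length_quotient_splittingIdeal_le {p : ℕ} {R : Type u} [CommRing R]
    [IsLocalRing R] [ExpChar R p] (D : CartierSubalgebra p R) {t : ℕ} {ι : Type*} [Fintype ι]
    {ψ : ι → CartierMap p t R} (hψ : ∀ i, ψ i ∈ D.component t) {z : R}
    (hz : ∀ c : ι → R, ∃ x, ∀ i, ψ i x = z * c i) (e : ℕ) :
    Fintype.card ι * Module.length R
        (FrobeniusPushforward p e R ⧸ FrobeniusPushforward.ofIdeal p e (D.splittingIdeal e)) ≤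
      Module.length R (FrobeniusPushforward p (e + t) R ⧸
          FrobeniusPushforward.ofIdeal p (e + t) (D.splittingIdeal (e + t))) +
        Fintype.card ι * Module.length R (FrobeniusPushforward p e R ⧸
          FrobeniusPushforward.ofIdeal p e (D.splittingIdeal e ⊔ Ideal.span {z})) := by
  refine card_mul_length_quotient_le (Ψ := fun i => (ψ i).pushforward e)
    (FrobeniusPushforward.ofIdeal_mono p e le_sup_left)
    (fun i x hx => map_mem_splittingIdeal (hψ i) hx) fun w hw => ?_
  have hmod : ∀ i, ∃ c, (FrobeniusPushforward.of p e).symm (w i) - z * c ∈ D.splittingIdeal e := by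
    intro i
    obtain ⟨a, ha, b, hb, hab⟩ := Submodule.mem_sup.mp (FrobeniusPushforward.mem_ofIdeal.mp (hw i))
    obtain ⟨c, rfl⟩ := Ideal.mem_span_singleton.mp hb
    exact ⟨c, by rwa [← hab, add_sub_cancel_right]⟩
  choose c hc using hmod
  obtain ⟨x, hx⟩ := hz c
  refine ⟨.of p (e + t) ((FrobeniusPushforward.of p t).symm x), fun i => ?_⟩
  change (FrobeniusPushforward.of p e).symm (w i) - ψ i x ∈ D.splittingIdeal e
  rw [hx]
  exact hc i

open IsLocalRing

variable {p : ℕ} [Fact p.Prime] {R : Type u} [CommRing R] [IsLocalRing R] [IsNoetherianRing R]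
  [CharP R p] {d : ℕ} {D : CartierSubalgebra p R}

theorem splittingNumber_le_frobeniusDegree_pow [IsDomain R] (hR : IsFFinite p R)
    (D : CartierSubalgebra p R) (e : ℕ) : D.splittingNumber e ≤ frobeniusDegree p R ^ e := by
  obtain ⟨φ, v, -, h, -⟩ := D.exists_isBiorthogonal_splittingNumber hR e
  have := hR.finite_pushforward e
  simpa [FrobeniusPushforward.finrank_eq] using h.linearIndependent.fintype_card_le_finrank

theorem exists_frobeniusDegree_pow_mul_splittingNumber_le [IsDomain R] (hR : IsFFinite p R)
    (hd : ringKrullDim R ≤ d) {t : ℕ} (ht : t ∈ D.semigroup) :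
    ∃ C : ℕ, ∀ e, p ^ e * (frobeniusDegree p R ^ t * D.splittingNumber e) ≤
      p ^ e * D.splittingNumber (e + t) + C * frobeniusGrowth p d R ^ e := by
  obtain ⟨φ, hφ, y, hy⟩ := (mem_semigroup_iff hR).mp ht
  have hφ0 : φ ≠ 0 := by
    rintro rfl
    exact zero_ne_one hy
  have := hR.finite_pushforward t
  obtain ⟨x, z, hz, hsurj⟩ := exists_forall_exists_pairing_eq_mul (φ.pairing_injective hφ0)
  obtain ⟨C, hC⟩ := exists_mul_length_quotient_le_mul_pow hd (mem_nonZeroDivisors_of_ne_zero hz)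
  refine ⟨frobeniusDegree p R ^ t * C, fun e => ?_⟩
  set κ := frobeniusDegree p (ResidueField R) with hκ
  have hle := D.card_mul_length_quotient_splittingIdeal_le
    (fun i => pairing_mem_component hφ (x i)) hsurj e
  simp only [FrobeniusPushforward.length_quotient_ofIdeal hR, Fintype.card_fin,
    FrobeniusPushforward.finrank_eq, ← splittingNumber_eq_length_mul hR] at hle
  have hsmall := hC (p ^ e) (D.splittingIdeal e ⊔ Ideal.span {z})
    (pow_pos (Fact.out : p.Prime).pos e)
    (Ideal.mem_sup_right (Ideal.mem_span_singleton_self z))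
    fun x hx => Ideal.mem_sup_left (pow_mem_splittingIdeal e hx)
  have hcast : ((p ^ e * (frobeniusDegree p R ^ t * D.splittingNumber e) : ℕ) : ℕ∞) ≤
      (p ^ e * D.splittingNumber (e + t) +
        frobeniusDegree p R ^ t * C * frobeniusGrowth p d R ^ e : ℕ) :=
    calc ((p ^ e * (frobeniusDegree p R ^ t * D.splittingNumber e) : ℕ) : ℕ∞)
        = (p ^ e : ℕ) * ((frobeniusDegree p R ^ t : ℕ) * D.splittingNumber e) := by push_cast; ring
      _ ≤ (p ^ e : ℕ) * (D.splittingNumber (e + t) + (frobeniusDegree p R ^ t : ℕ) *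
            (Module.length R (R ⧸ D.splittingIdeal e ⊔ Ideal.span {z}) * (κ ^ e : ℕ))) := by
        gcongr
      _ = (p ^ e : ℕ) * D.splittingNumber (e + t) + (frobeniusDegree p R ^ t : ℕ) * (κ ^ e : ℕ) *
            ((p ^ e : ℕ) * Module.length R (R ⧸ D.splittingIdeal e ⊔ Ideal.span {z})) := by ring
      _ ≤ (p ^ e : ℕ) * D.splittingNumber (e + t) + (frobeniusDegree p R ^ t : ℕ) * (κ ^ e : ℕ) *
            (C * (p ^ e) ^ d : ℕ) := by gcongr
      _ = _ := by rw [frobeniusGrowth, ← hκ]; push_cast; ring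
  exact_mod_cast hcast

end CartierSubalgebra

/-! ### Reduced rings that are not domains -/

theorem CartierMap.map_mem_annihilator {p e : ℕ} {R : Type u} [CommRing R] [ExpChar R p]
    (φ : CartierMap p e R) {I : Ideal R} {a : R} (ha : a ∈ I.annihilator) :
    φ (.of p e a) ∈ I.annihilator := by
  refine Submodule.mem_annihilator.mpr fun b hb => ?_
  have hab : b ^ p ^ e * a = 0 := by
    rw [← pow_sub_one_mul (expChar_pow_pos R p e).ne' b, mul_assoc, mul_comm b a]
    exact mul_eq_zero_of_right _ (Submodule.mem_annihilator.mp ha b hb)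
  rw [smul_eq_mul, mul_comm, ← φ.map_pow_mul, hab, map_zero, map_zero]

theorem exists_mem_sup_annihilator_mem_nonZeroDivisors {R : Type*} [CommRing R]
    [IsNoetherianRing R] [IsReduced R] (I : Ideal R) :
    ∃ z ∈ I ⊔ I.annihilator, z ∈ nonZeroDivisors R := by
  have hbot : (I ⊔ I.annihilator).annihilator = ⊥ := by
    refine (Submodule.eq_bot_iff _).mpr fun a ha => ?_
    have ha' := Submodule.mem_annihilator.mp ha
    have haI : a ∈ I.annihilator :=
      Submodule.mem_annihilator.mpr fun b hb => ha' b (Ideal.mem_sup_left hb)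
    exact eq_zero_of_pow_eq_zero (n := 2) ((pow_two a).trans (ha' a (Ideal.mem_sup_right haI)))
  have : FaithfulSMul R (I ⊔ I.annihilator : Ideal R) := Module.annihilator_eq_bot.mp hbot
  exact Ideal.nonempty_inter_nonZeroDivisors_of_faithfulSMul

namespace CartierSubalgebra

open IsLocalRing

theorem annihilator_le_splittingIdeal {p : ℕ} {R : Type u} [CommRing R] [IsLocalRing R]
    [ExpChar R p] (D : CartierSubalgebra p R) {I : Ideal R} (hI : I ≠ ⊥) (e : ℕ) :
    I.annihilator ≤ D.splittingIdeal e := fun _ ha =>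
  mem_splittingIdeal.mpr fun φ _ =>
    le_maximalIdeal (mt Submodule.annihilator_eq_top_iff.mp hI) (φ.map_mem_annihilator ha)

theorem exists_mem_splittingIdeal_of_not_isDomain {p : ℕ} {R : Type u} [CommRing R]
    [IsLocalRing R] [IsNoetherianRing R] [IsReduced R] [ExpChar R p] (D : CartierSubalgebra p R)
    (h : ¬IsDomain R) : ∃ z ∈ nonZeroDivisors R, ∀ e, z ∈ D.splittingIdeal e := by
  obtain ⟨x, y, hxy, hx, hy⟩ : ∃ x y : R, x * y = 0 ∧ x ≠ 0 ∧ y ≠ 0 := by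
    by_contra! hxy
    have : NoZeroDivisors R := ⟨fun {a b} hab => or_iff_not_imp_left.mpr (hxy a b hab)⟩
    exact h (NoZeroDivisors.to_isDomain R)
  set J := (Ideal.span {x}).annihilator
  have hyJ : y ∈ J := by
    rw [Submodule.mem_annihilator_span_singleton, smul_eq_mul, mul_comm, hxy]
  obtain ⟨z, hzJ, hz⟩ := exists_mem_sup_annihilator_mem_nonZeroDivisors J
  have hle (e : ℕ) : J ⊔ J.annihilator ≤ D.splittingIdeal e :=
    sup_le (D.annihilator_le_splittingIdeal (mt Ideal.span_singleton_eq_bot.mp hx) e)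
      (D.annihilator_le_splittingIdeal ((Submodule.ne_bot_iff J).mpr ⟨y, hyJ, hy⟩) e)
  exact ⟨z, hz, fun e => hle e hzJ⟩

theorem exists_pow_mul_splittingNumber_le_of_not_isDomain {p : ℕ} [Fact p.Prime] {R : Type u}
    [CommRing R] [IsLocalRing R] [IsNoetherianRing R] [IsReduced R] [CharP R p] {d : ℕ}
    (hR : IsFFinite p R) (hd : ringKrullDim R ≤ d) (D : CartierSubalgebra p R) (h : ¬IsDomain R) :
    ∃ C : ℕ, ∀ e, p ^ e * D.splittingNumber e ≤ C * frobeniusGrowth p d R ^ e := by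
  obtain ⟨z, hz, hzI⟩ := D.exists_mem_splittingIdeal_of_not_isDomain h
  obtain ⟨C, hC⟩ := exists_mul_length_quotient_le_mul_pow hd hz
  refine ⟨C, fun e => ?_⟩
  have hle : (p ^ e : ℕ) * (D.splittingNumber e : ℕ∞) ≤
      (C * (p ^ e) ^ d : ℕ) * (frobeniusDegree p (ResidueField R) ^ e : ℕ) := by
    rw [splittingNumber_eq_length_mul hR, ← mul_assoc]
    gcongr
    exact hC _ _ (pow_pos (Fact.out : p.Prime).pos e) (hzI e) fun _ => pow_mem_splittingIdeal e
  rw [frobeniusGrowth, mul_pow, pow_right_comm, ← mul_assoc]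
  exact_mod_cast hle

end CartierSubalgebra

/-! ### Sequences increasing up to a geometric error -/

section Sequences

theorem exists_tendsto_of_le_add {u ε : ℕ → ℝ} (hbelow : BddBelow (Set.range u))
    (habove : BddAbove (Set.range u)) (hε : Tendsto ε atTop (𝓝 0)) {J : ℕ}
    (h : ∀ m, ∀ j ≥ J, u m ≤ u (m + j) + ε m) : ∃ L, Tendsto u atTop (𝓝 L) := by
  have hbdd : IsBoundedUnder (· ≥ ·) atTop u := hbelow.isBoundedUnder_of_range
  have hcob : IsCoboundedUnder (· ≥ ·) atTop u :=
    habove.isBoundedUnder_of_range.isCoboundedUnder_ge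
  have hle (m : ℕ) : u m ≤ liminf u atTop + ε m := by
    rw [← sub_le_iff_le_add]
    refine le_liminf_of_le hcob ?_
    filter_upwards [eventually_ge_atTop (m + J)] with k hk
    obtain ⟨j, rfl⟩ := Nat.exists_eq_add_of_le (Nat.le_of_add_right_le hk)
    exact sub_le_iff_le_add.mpr (h m j (by omega))
  refine ⟨liminf u atTop, tendsto_order.mpr ⟨fun c hc => eventually_lt_of_lt_liminf hc hbdd,
    fun c hc => ?_⟩⟩
  filter_upwards [hε.eventually_lt_const (sub_pos.mpr hc)] with m hm
  linarith [hle m]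

variable {s : ℕ → ℝ} {q : ℝ}

/-- A geometric series bounds the accumulated error. -/
theorem le_add_of_mem_closure {G : Set ℕ} {C : ℝ} (hG : 0 ∉ G) (hC : 0 ≤ C) (hq : 2 ≤ q)
    (h : ∀ t ∈ G, ∀ e, s e ≤ s (e + t) + C / q ^ e) {t : ℕ} (ht : t ∈ AddSubmonoid.closure G)
    (e : ℕ) : s e ≤ s (e + t) + 2 * C / q ^ e := by
  induction ht using AddSubmonoid.closure_induction_left generalizing e with
  | zero =>
    rw [add_zero]
    exact le_add_of_nonneg_right (by positivity)
  | add_left x hx y _ ih =>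
    have hqx : 2 ≤ q ^ x :=
      hq.trans (le_self_pow₀ (one_le_two.trans hq) (ne_of_mem_of_not_mem hx hG))
    have htail : 2 * C / q ^ (e + x) ≤ C / q ^ e := by
      rw [pow_add, mul_comm 2 C, mul_div_mul_comm]
      exact mul_le_of_le_one_right (by positivity) ((div_le_one (by positivity)).mpr hqx)
    calc s e ≤ s (e + x) + C / q ^ e := h x hx e
      _ ≤ s (e + x + y) + 2 * C / q ^ (e + x) + C / q ^ e := by gcongr; exact ih _
      _ ≤ s (e + x + y) + C / q ^ e + C / q ^ e := by gcongr
      _ = s (e + (x + y)) + 2 * C / q ^ e := by rw [← add_assoc]; ring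

variable {n n₀ : ℕ} {Γ : Set ℕ}

theorem exists_le_add_of_forall_mem (hn : n ≠ 0) (hΓ : ∀ m ≥ n₀, n ∣ m → m ∈ Γ) (hq : 2 ≤ q)
    (h : ∀ t ∈ Γ, ∃ C, ∀ e, s e ≤ s (e + t) + C / q ^ e) :
    ∃ (C : ℝ) (J : ℕ), ∀ e, ∀ j ≥ J, s e ≤ s (e + j * n) + C / q ^ e := by
  have hmem (i : ℕ) : (n₀ + i) * n ∈ Γ :=
    hΓ _ ((Nat.le_add_right _ _).trans (Nat.le_mul_of_pos_right _ (Nat.pos_of_ne_zero hn)))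
      (dvd_mul_left _ _)
  obtain ⟨C₁, hC₁⟩ := h _ (hmem 1)
  obtain ⟨C₂, hC₂⟩ := h _ (hmem 2)
  let G : Set ℕ := {(n₀ + 1) * n, (n₀ + 2) * n}
  have hstep : ∀ t ∈ G, ∀ e, s e ≤ s (e + t) + max 0 (max C₁ C₂) / q ^ e := by
    rintro t (rfl | rfl) e
    · exact (hC₁ e).trans (by gcongr; simp)
    · exact (hC₂ e).trans (by gcongr; simp)
  have hG : 0 ∉ G := by simp [G, hn]
  have hgcd : Nat.setGcd G ∣ n := by
    have hdvd := Nat.dvd_sub (Nat.setGcd_dvd_of_mem (show (n₀ + 2) * n ∈ G from .inr rfl))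
      (Nat.setGcd_dvd_of_mem (show (n₀ + 1) * n ∈ G from .inl rfl))
    rwa [← Nat.sub_mul, Nat.add_sub_add_left, Nat.add_one_sub_one, one_mul] at hdvd
  obtain ⟨J, hJ⟩ := Nat.exists_mem_closure_of_ge G
  exact ⟨_, J, fun e j hj => le_add_of_mem_closure hG (le_max_left _ _) hq hstep
    (hJ _ (hj.trans (Nat.le_mul_of_pos_right _ (Nat.pos_of_ne_zero hn)))
      (hgcd.trans (dvd_mul_left _ _))) e⟩

theorem exists_tendsto_mul_of_le_add (hn : n ≠ 0) (hΓ : ∀ m ≥ n₀, n ∣ m → m ∈ Γ)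
    (hbelow : BddBelow (Set.range s)) (habove : BddAbove (Set.range s)) (hq : 2 ≤ q)
    (h : ∀ t ∈ Γ, ∃ C, ∀ e, s e ≤ s (e + t) + C / q ^ e) :
    ∃ L, Tendsto (fun m => s (m * n)) atTop (𝓝 L) := by
  obtain ⟨C, J, hC⟩ := exists_le_add_of_forall_mem hn hΓ hq h
  have hrange : Set.range (fun m => s (m * n)) ⊆ Set.range s :=
    Set.range_comp_subset_range (· * n) s
  have herror : Tendsto (fun m : ℕ => C / q ^ (m * n)) atTop (𝓝 0) :=
    ((tendsto_pow_atTop_atTop_of_one_lt (one_lt_two.trans_le hq)).comp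
      (tendsto_id.atTop_mul_const' (Nat.pos_of_ne_zero hn))).const_div_atTop C
  refine exists_tendsto_of_le_add (hbelow.mono hrange) (habove.mono hrange) herror (J := J)
    fun m j hj => ?_
  rw [add_mul]
  exact hC _ j hj

theorem tendsto_inf_principal_of_tendsto_mul {α : Type*} {f : ℕ → α} {l : Filter α} (hn : n ≠ 0)
    (hΓ : ∀ m ∈ Γ, n ∣ m) (hf : Tendsto (fun m => f (m * n)) atTop l) :
    Tendsto f (atTop ⊓ 𝓟 Γ) l := by
  refine (hf.comp ((Nat.tendsto_div_const_atTop hn).mono_left inf_le_left)).congr' ?_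
  filter_upwards [mem_inf_of_right (mem_principal_self Γ)] with m hm
  exact congrArg f (Nat.div_mul_cancel (hΓ m hm))

end Sequences

/-! ### The `F`-signature -/

theorem frobeniusGrowth_pos {p : ℕ} [Fact p.Prime] {R : Type*} [CommRing R] [IsLocalRing R]
    [CharP R p] (hR : IsFFinite p R) (d : ℕ) : 0 < frobeniusGrowth p d R :=
  Nat.mul_pos (pow_pos (Fact.out : p.Prime).pos d) hR.frobeniusDegree_residueField_pos

theorem frobeniusGrowth_eq_rpow {p : ℕ} [Fact p.Prime] {R : Type*} [CommRing R] [IsLocalRing R]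
    [CharP R p] (hR : IsFFinite p R) (d : ℕ) :
    (frobeniusGrowth p d R : ℝ) = (p : ℝ) ^ (d + frobeniusAlpha p R) := by
  have hp : (1 : ℝ) < p := by exact_mod_cast (Fact.out : p.Prime).one_lt
  have hκ : (0 : ℝ) < frobeniusDegree p (IsLocalRing.ResidueField R) := by
    exact_mod_cast hR.frobeniusDegree_residueField_pos
  rw [frobeniusAlpha, RestrictScalarsAlong.finrank_fieldRange, ← frobeniusDegree,
    Real.rpow_add (by positivity), Real.rpow_natCast, Real.rpow_logb (by positivity) hp.ne' hκ,
    frobeniusGrowth, Nat.cast_mul, Nat.cast_pow]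

namespace CartierSubalgebra

section

variable {p : ℕ} [Fact p.Prime] {R : Type u} [CommRing R] [IsLocalRing R] [CharP R p]

theorem normalizedSplittingNumber_eq_div_pow (hR : IsFFinite p R) (D : CartierSubalgebra p R)
    (d e : ℕ) : D.normalizedSplittingNumber d e =
      D.splittingNumber e / (frobeniusGrowth p d R : ℝ) ^ e := by
  rw [normalizedSplittingNumber, frobeniusGrowth_eq_rpow hR, mul_comm,
    Real.rpow_mul_natCast (Nat.cast_nonneg p)]

theorem normalizedSplittingNumber_nonneg (D : CartierSubalgebra p R) (d e : ℕ) :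
    0 ≤ D.normalizedSplittingNumber d e := by
  rw [normalizedSplittingNumber]
  positivity

end

variable {p : ℕ} [Fact p.Prime] {R : Type u} [CommRing R] [IsLocalRing R] [IsNoetherianRing R]
  [CharP R p] {d : ℕ} {D : CartierSubalgebra p R}

theorem bddAbove_range_normalizedSplittingNumber (hR : IsFFinite p R) (hd : ringKrullDim R ≤ d)
    (D : CartierSubalgebra p R) : BddAbove (Set.range (D.normalizedSplittingNumber d)) := by
  have hδ := frobeniusGrowth_pos hR d
  obtain ⟨C, hC⟩ := exists_splittingNumber_le hR hd D
  refine ⟨C, Set.forall_mem_range.mpr fun e => ?_⟩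
  rw [normalizedSplittingNumber_eq_div_pow hR, div_le_iff₀ (by positivity)]
  exact_mod_cast hC e

theorem tendsto_normalizedSplittingNumber_zero_of_not_isDomain [IsReduced R] (hR : IsFFinite p R)
    (hd : ringKrullDim R ≤ d) (D : CartierSubalgebra p R) (h : ¬IsDomain R) :
    Tendsto (D.normalizedSplittingNumber d) atTop (𝓝 0) := by
  have hδ := frobeniusGrowth_pos hR d
  have hp : (1 : ℝ) < p := by exact_mod_cast (Fact.out : p.Prime).one_lt
  obtain ⟨C, hC⟩ := exists_pow_mul_splittingNumber_le_of_not_isDomain hR hd D h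
  refine squeeze_zero (D.normalizedSplittingNumber_nonneg d) (fun e => ?_)
    ((tendsto_pow_atTop_atTop_of_one_lt hp).const_div_atTop (C : ℝ))
  rw [normalizedSplittingNumber_eq_div_pow hR, div_le_div_iff₀ (by positivity) (by positivity),
    mul_comm]
  exact_mod_cast hC e

theorem tendsto_normalizedSplittingNumber_zero_of_lt [IsDomain R] (hR : IsFFinite p R)
    (D : CartierSubalgebra p R) (h : frobeniusDegree p R < frobeniusGrowth p d R) :
    Tendsto (D.normalizedSplittingNumber d) atTop (𝓝 0) := by
  have hδ := frobeniusGrowth_pos hR d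
  have hlt : (frobeniusDegree p R : ℝ) / frobeniusGrowth p d R < 1 := by
    rw [div_lt_one (by positivity)]
    exact_mod_cast h
  refine squeeze_zero (D.normalizedSplittingNumber_nonneg d) (fun e => ?_)
    (tendsto_pow_atTop_nhds_zero_of_lt_one (by positivity) hlt)
  rw [normalizedSplittingNumber_eq_div_pow hR, div_pow]
  gcongr
  exact_mod_cast splittingNumber_le_frobeniusDegree_pow hR D e

theorem exists_normalizedSplittingNumber_le_add [IsDomain R] (hR : IsFFinite p R)
    (hd : ringKrullDim R ≤ d) (h : frobeniusGrowth p d R ≤ frobeniusDegree p R) {t : ℕ}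
    (ht : t ∈ D.semigroup) : ∃ C : ℝ, ∀ e, D.normalizedSplittingNumber d e ≤
      D.normalizedSplittingNumber d (e + t) + C / (p : ℝ) ^ e := by
  obtain ⟨C, hC⟩ := exists_frobeniusDegree_pow_mul_splittingNumber_le hR hd ht
  have hδ := frobeniusGrowth_pos hR d
  have hp := (Fact.out : p.Prime).pos
  simp only [normalizedSplittingNumber_eq_div_pow hR]
  set δ := frobeniusGrowth p d R
  refine ⟨C / δ ^ t, fun e => ?_⟩
  have hle : (p : ℝ) ^ e * (δ ^ t * D.splittingNumber e) ≤
      p ^ e * D.splittingNumber (e + t) + C * δ ^ e := by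
    exact_mod_cast (by gcongr : p ^ e * (δ ^ t * D.splittingNumber e) ≤ _).trans (hC e)
  calc (D.splittingNumber e : ℝ) / δ ^ e
      = p ^ e * (δ ^ t * D.splittingNumber e) / (p ^ e * δ ^ (e + t)) := by field_simp; ring
    _ ≤ (p ^ e * D.splittingNumber (e + t) + C * δ ^ e) / (p ^ e * δ ^ (e + t)) := by gcongr
    _ = D.splittingNumber (e + t) / δ ^ (e + t) + C / δ ^ t / p ^ e := by field_simp; ring

theorem exists_tendsto_normalizedSplittingNumber_mul (hR : IsFFinite p R)
    (hd : ringKrullDim R ≤ d) (hn : D.semigroupIndex ≠ 0) :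
    ∃ L, Tendsto (fun m => D.normalizedSplittingNumber d (m * D.semigroupIndex)) atTop (𝓝 L) := by
  have hmul : Tendsto (· * D.semigroupIndex) atTop atTop :=
    tendsto_id.atTop_mul_const' (Nat.pos_of_ne_zero hn)
  obtain ⟨e, he, he0⟩ := Nat.exists_ne_zero_of_setGcd_ne_zero hn
  have : IsReduced R := isReduced_of_mem_semigroup hR he0 he
  by_cases hdomain : IsDomain R
  · obtain hlt | hle := lt_or_ge (frobeniusDegree p R) (frobeniusGrowth p d R)
    · exact ⟨0, (tendsto_normalizedSplittingNumber_zero_of_lt hR D hlt).comp hmul⟩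
    · obtain ⟨n₀, hn₀⟩ := D.exists_mem_semigroup_of_ge hR
      exact exists_tendsto_mul_of_le_add hn hn₀
        ⟨0, Set.forall_mem_range.mpr (D.normalizedSplittingNumber_nonneg d)⟩
        (bddAbove_range_normalizedSplittingNumber hR hd D)
        (by exact_mod_cast (Fact.out : p.Prime).two_le)
        fun t ht => exists_normalizedSplittingNumber_le_add hR hd hle ht
  · exact ⟨0, (tendsto_normalizedSplittingNumber_zero_of_not_isDomain hR hd D hdomain).comp hmul⟩

end CartierSubalgebra

theorem theorem3p9 (p : ℕ) [Fact p.Prime] (R : Type u) [CommRing R] [IsLocalRing R]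
    [IsNoetherianRing R] [CharP R p] (hF : IsFFinite p R) (d : ℕ) (hd : ringKrullDim R = d)
    (D : CartierSubalgebra p R) :
    (D.semigroupIndex ≠ 0 →
      D.semigroup.Infinite ∧
      Tendsto (D.normalizedSplittingNumber d) (atTop ⊓ 𝓟 D.semigroup) (𝓝 (D.fSignature d)) ∧
      Tendsto (fun m : ℕ => D.normalizedSplittingNumber d (m * D.semigroupIndex)) atTop
        (𝓝 (D.fSignature d))) ∧
    (D.semigroupIndex = 0 →
      (∀ e : ℕ, 0 < e → D.splittingNumber e = 0) ∧ D.fSignature d = 0) := by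
  refine ⟨fun hn => ?_, fun hn => ⟨fun e he => ?_, if_pos hn⟩⟩
  · have hinf : D.semigroup.Infinite := D.infinite_semigroup hF hn
    have hne : (atTop ⊓ 𝓟 D.semigroup).NeBot :=
      Nat.cofinite_eq_atTop ▸ hinf.cofinite_inf_principal_neBot
    obtain ⟨L, hmul⟩ := D.exists_tendsto_normalizedSplittingNumber_mul hF hd.le hn
    have hΓ : Tendsto (D.normalizedSplittingNumber d) (atTop ⊓ 𝓟 D.semigroup) (𝓝 L) :=
      tendsto_inf_principal_of_tendsto_mul hn (fun _ he => Nat.setGcd_dvd_of_mem he) hmul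
    have hL : D.fSignature d = L := (if_neg hn).trans hΓ.limUnder_eq
    exact ⟨hinf, hL ▸ hΓ, hL ▸ hmul⟩
  · by_contra h
    exact he.ne' (Nat.setGcd_eq_zero_iff.mp hn (show e ∈ D.semigroup from h))
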